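/- All graphs are finite and simple. For a graph $G$, let $\lambda(G)$ be the largest eigenvalue of its adjacency matrix; $\mathrm{spex}(n,T)$ is the maximum of $\lambda(G)$ over all $n$-vertex graphs $G$ containing no copy of $T$ as a (not necessarily induced) subgraph, and $\mathrm{SPEX}(n,T)$ is the set of $n$-vertex $T$-free graphs $G$ with $\lambda(G)=\mathrm{spex}(n,T)$. Write $G_1\vee G_2$ for the join of two graphs, $\overline{K_l}$ for the graph on $l$ vertices without edges, $S_\delta=K_{1,\delta-1}$ for the star on $\delta$ vertices, and $mS_\delta$ for $m$ vertex-disjoint copies of it. Let $\mathcal T^{\delta}_{m,l+1}$ be the set of trees on $m$ vertices whose bipartition $\{A,B\}$ satisfies $l+1=|A|\le|B|$ and $\min_{v\in A}d_T(v)=\delta$. Put $$f(x,n)=\frac{l+x-1+\sqrt{(l+x-1)^2+4(nl+x-lx-l^2)}}{2}.$$ **Theorem.** Let $T\in\mathcal T^{\delta}_{m,l+1}$ for some natural numbers $m,l,\delta$, and suppose that $\overline{K_l}\vee mS_\delta$ contains a copy of $T$ as a subgraph. Then there exists $N\in\mathbb N$ such that for all $n>N$ the following hold. 1. Every $G\in\mathrm{SPEX}(n,T)$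 is isomorphic to $K_l\vee H_2$ for some graph $H_2$ on $n-l$ vertices with maximum degree $\Delta(H_2)\le\delta-1$ and with at most $(m-1)\left((\delta-1)^2+1\right)$ vertices of degree $\delta-1$. 2. $$f(\delta-2,n)\le\mathrm{spex}(n,T)\le f(\delta-2,n)+\frac{2(m-1)\left((\delta-1)^2+1\right)}{n}.$$ -/

import Mathlib

namespace TreeSpex

/-- The spectral radius `λ(G)`: the largest (real) eigenvalue of the adjacency matrix of `G`. -/
noncomputable def lam {V : Type*} [Fintype V] (G : SimpleGraph V) : ℝ := by
  classical exact sSup (spectrum ℝ (G.adjMatrix ℝ))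

/-- The set of eigenvalues has a greatest element, so that `lam G` is the largest eigenvalue. -/
theorem isGreatest_lam {V : Type*} [Fintype V] [DecidableEq V] [Nonempty V]
    (G : SimpleGraph V) [DecidableRel G.Adj] :
    IsGreatest (spectrum ℝ (G.adjMatrix ℝ)) (lam G) := by
  have hA : (G.adjMatrix ℝ).IsHermitian := by
    rw [Matrix.IsHermitian, Matrix.conjTranspose_eq_transpose_of_trivial]
    exact SimpleGraph.isSymm_adjMatrix G
  have hs := hA.spectrum_real_eq_range_eigenvalues
  have hl : lam G = sSup (spectrum ℝ (G.adjMatrix ℝ)) := by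
    unfold lam
    congr!
  have hf : (spectrum ℝ (G.adjMatrix ℝ)).Finite := by rw [hs]; exact Set.finite_range _
  have hn : (spectrum ℝ (G.adjMatrix ℝ)).Nonempty := by rw [hs]; exact Set.range_nonempty _
  rw [hl]
  exact ⟨hn.csSup_mem hf, fun x hx => le_csSup hf.bddAbove hx⟩

/-- The spectral extremal number `spex(n, F)`: the maximum of `λ(G)` over all graphs `G` on `n`
vertices that contain no copy of `F` (as a not necessarily induced subgraph). -/
noncomputable def spex {V : Type*} (n : ℕ) (F : SimpleGraph V) : ℝ :=
  sSup {x : ℝ | ∃ G : SimpleGraph (Fin n), F.Free G ∧ lam G = x}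

/-- The maximum in `spex` is attained as soon as some graph on `n` vertices is `F`-free. -/
theorem isGreatest_spex {V : Type*} (n : ℕ) (F : SimpleGraph V)
    (h : ∃ G : SimpleGraph (Fin n), F.Free G) :
    IsGreatest {x : ℝ | ∃ G : SimpleGraph (Fin n), F.Free G ∧ lam G = x} (spex n F) := by
  have hf : {x : ℝ | ∃ G : SimpleGraph (Fin n), F.Free G ∧ lam G = x}.Finite :=
    (Set.finite_range (fun G : SimpleGraph (Fin n) => lam G)).subset
      (by rintro x ⟨G, -, rfl⟩; exact ⟨G, rfl⟩)
  obtain ⟨G, hG⟩ := h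
  have hn : {x : ℝ | ∃ G : SimpleGraph (Fin n), F.Free G ∧ lam G = x}.Nonempty :=
    ⟨lam G, G, hG, rfl⟩
  exact ⟨hn.csSup_mem hf, fun x hx => le_csSup hf.bddAbove hx⟩

/-- The set `SPEX(n, F)` of spectral extremal graphs. -/
def SPEX {V : Type*} (n : ℕ) (F : SimpleGraph V) : Set (SimpleGraph (Fin n)) :=
  {G | F.Free G ∧ lam G = spex n F}

/-- The join `G ∨ H`: the disjoint union of `G` and `H` together with all edges between them. -/
def join {V W : Type*} (G : SimpleGraph V) (H : SimpleGraph W) : SimpleGraph (V ⊕ W) :=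
  (G ⊕g H) ⊔ completeBipartiteGraph V W

/-- `m` vertex-disjoint copies of `G`. -/
def copies {V : Type*} (m : ℕ) (G : SimpleGraph V) : SimpleGraph (Fin m × V) where
  Adj p q := p.1 = q.1 ∧ G.Adj p.2 q.2
  symm := ⟨fun _ _ h => ⟨h.1.symm, h.2.symm⟩⟩
  loopless := ⟨fun _ h => G.irrefl h.2⟩

/-- The star `S_δ = K_{1,δ-1}` on `δ` vertices (used for `δ ≥ 1`). -/
def star (δ : ℕ) : SimpleGraph (Fin 1 ⊕ Fin (δ - 1)) :=
  completeBipartiteGraph (Fin 1) (Fin (δ - 1))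

open Classical in
/-- `T` belongs to the family `𝒯^δ_{m,k}`: it is a tree on `m` vertices with bipartition `{A, B}`,
`|A| ≤ |B|`, `|A| = k`, and `δ` is the minimum of the degrees in `T` of the vertices of `A`. -/
def TreeFamily {V : Type*} [Fintype V] (m k δ : ℕ) (T : SimpleGraph V) : Prop :=
  T.IsTree ∧ Fintype.card V = m ∧
    ∃ A B : Finset V, T.IsBipartiteWith (A : Set V) (B : Set V) ∧ A ∪ B = Finset.univ ∧
      A.card ≤ B.card ∧ A.card = k ∧ IsLeast {d : ℕ | ∃ v ∈ A, T.degree v = d} δ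

/-- `f(x, n) = (l + x - 1 + √((l + x - 1)² + 4(nl + x - lx - l²))) / 2`. -/
noncomputable def f (l : ℕ) (x : ℝ) (n : ℕ) : ℝ :=
  (l + x - 1 + Real.sqrt ((l + x - 1) ^ 2 + 4 * (n * l + x - l * x - (l : ℝ) ^ 2))) / 2

end TreeSpex

/-! Write `d = δ - 2`. Two facts about copies of `T` in joins govern the proof. Deleting at most `l`
vertices from `T` leaves a vertex of degree at least `δ` or two of degree at least `δ - 1`
(`IsHalf.exists_card_nbr_sdiff`, an edge count in a forest). So `K_l ∨ H` is `T`-free when the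
degrees in `H` are at most `d`, except for one vertex of degree `d + 1`. Conversely, `l` vertices
joined to a large set, plus one vertex with `δ` neighbours in that set, already contain `T`
(`isContained_of_hub`). Since `f l d n` is the larger root of `(q - d)(q - (l - 1)) = l(n - l)`, the
characteristic equation of the quotient matrix of `K_l ∨ (d-regular)`, the first fact gives the
lower bound.

Now let `G` be extremal. Being `T`-free it is degenerate, so it has an orientation with bounded
out-degrees and `λ = O(√n)`. Boundedly many vertices have linear degree; the edges avoiding them
contribute little to the quadratic form, while `λ² ≥ l(n - l)`. As sets of `l + 1` vertices have few
common neighbours, Cauchy–Schwarz must be nearly tight at almost every vertex, which forces almost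
all vertices to share the same `l` neighbours `L` (`eventually_exists_hub`). The Perron entries are
large on `L` and small elsewhere, so replacing the neighbourhood of every exceptional vertex by `L`
would raise `λ` without creating `T`; hence there is no exceptional vertex
(`eventually_exists_dominating`).

Thus `G = G₁ ∨ H` with `|G₁| = l`. The hub lemma bounds the degrees in `H` by `d + 1`. Too many
vertices of degree `d + 1` would include `m` with disjoint closed neighbourhoods, hence `mS_δ` in
`H` and `T` in `G`. Summing the eigenvalue equation over each side of the join shows that an edge
missing in `G₁` costs more than the few vertices of degree `d + 1` can gain (`eq_top_of_le_lam`),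
and bounds `λ` from above once `G₁` is complete (`lam_join_top_le`). -/

namespace TreeSpex
open Finset

/-! ### Spectral radius, quadratic form and Perron vectors -/

/-- The set of neighbours of a vertex, as a finset. -/
noncomputable def nbr {α : Type*} [Fintype α] (G : SimpleGraph α) (v : α) : Finset α := by
  classical exact univ.filter (G.Adj v)

@[simp] lemma mem_nbr {α : Type*} [Fintype α] {G : SimpleGraph α} {v w : α} :
    w ∈ nbr G v ↔ G.Adj v w := by
  simp [nbr]

/-- The quadratic form of the adjacency matrix. -/
noncomputable def quad {α : Type*} [Fintype α] (G : SimpleGraph α) (y : α → ℝ) : ℝ :=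
  ∑ u, ∑ v ∈ nbr G u, y u * y v

lemma adjMatrix_mulVec_eq {α : Type*} [Fintype α] (G : SimpleGraph α) [DecidableRel G.Adj]
    (y : α → ℝ) (u : α) : (G.adjMatrix ℝ).mulVec y u = ∑ v ∈ nbr G u, y v := by
  rw [SimpleGraph.adjMatrix_mulVec_apply]
  congr 1
  ext; simp

section
variable {α : Type*} [Fintype α] [DecidableEq α] (G : SimpleGraph α) [DecidableRel G.Adj]

lemma posSemidef_lam_sub [Nonempty α] :
    (lam G • (1 : Matrix α α ℝ) - G.adjMatrix ℝ).PosSemidef := by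
  have hA : (G.adjMatrix ℝ).IsHermitian := by
    rw [Matrix.IsHermitian, Matrix.conjTranspose_eq_transpose_of_trivial]
    exact SimpleGraph.isSymm_adjMatrix G
  have hB : (lam G • (1 : Matrix α α ℝ) - G.adjMatrix ℝ).IsHermitian := by
    refine Matrix.IsHermitian.sub ?_ hA
    rw [Matrix.IsHermitian, Matrix.conjTranspose_smul, Matrix.conjTranspose_one]
    simp
  rw [hB.posSemidef_iff_eigenvalues_nonneg]
  intro i
  have h := hB.eigenvalues_mem_spectrum_real i
  generalize hB.eigenvalues i = μ at h ⊢
  rw [← Algebra.algebraMap_eq_smul_one, ← spectrum.singleton_sub_eq] at h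
  obtain ⟨a, ha, b, hb, hab⟩ := Set.mem_sub.1 h
  have := (isGreatest_lam G).2 hb
  simp only [Set.mem_singleton_iff] at ha
  simp only [Pi.zero_apply]
  linarith

lemma dotProduct_lam_sub (y : α → ℝ) :
    Star.star y ⬝ᵥ (lam G • (1 : Matrix α α ℝ) - G.adjMatrix ℝ).mulVec y
      = lam G * ∑ u, y u ^ 2 - quad G y := by
  simp only [dotProduct, Matrix.sub_mulVec, Matrix.smul_mulVec, Matrix.one_mulVec, Pi.sub_apply,
    Pi.smul_apply, adjMatrix_mulVec_eq, quad, smul_eq_mul, star_trivial]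
  rw [mul_sum, ← sum_sub_distrib]
  refine sum_congr rfl fun u _ => ?_
  rw [← mul_sum]
  ring
end

variable {α : Type*} [Fintype α]

lemma quad_le_lam (G : SimpleGraph α) (y : α → ℝ) : quad G y ≤ lam G * ∑ u, y u ^ 2 := by
  classical
  rcases isEmpty_or_nonempty α with h | h
  · simp [quad]
  have := (posSemidef_lam_sub G).dotProduct_mulVec_nonneg y
  rw [dotProduct_lam_sub] at this
  linarith

/-- Equality case of the Rayleigh bound: a positive semidefinite form vanishes only on the kernel of
its matrix. -/
lemma eigen_of_le_quad (G : SimpleGraph α) (y : α → ℝ) (h : lam G * ∑ u, y u ^ 2 ≤ quad G y)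
    (u : α) : ∑ v ∈ nbr G u, y v = lam G * y u := by
  classical
  have : Nonempty α := ⟨u⟩
  have h0 : Star.star y ⬝ᵥ (lam G • (1 : Matrix α α ℝ) - G.adjMatrix ℝ).mulVec y = 0 := by
    rw [dotProduct_lam_sub]
    linarith [quad_le_lam G y]
  rw [(posSemidef_lam_sub G).dotProduct_mulVec_zero_iff] at h0
  have h1 := congrFun h0 u
  simp only [Matrix.sub_mulVec, Matrix.smul_mulVec, Matrix.one_mulVec, Pi.sub_apply,
    Pi.smul_apply, adjMatrix_mulVec_eq, smul_eq_mul, Pi.zero_apply] at h1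
  linarith

lemma quad_eq_of_eigen {G : SimpleGraph α} {y : α → ℝ} {r : ℝ}
    (h : ∀ u, ∑ v ∈ nbr G u, y v = r * y u) : quad G y = r * ∑ u, y u ^ 2 := by
  simp only [quad, ← mul_sum, h]
  rw [mul_sum]
  exact sum_congr rfl fun u _ => by ring

/-- The largest eigenvalue of a graph has a nonnegative eigenvector. -/
lemma exists_perron [Nonempty α] (G : SimpleGraph α) :
    ∃ x : α → ℝ, (∀ u, 0 ≤ x u) ∧ x ≠ 0 ∧ ∀ u, ∑ v ∈ nbr G u, x v = lam G * x u := by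
  classical
  have h := (isGreatest_lam G).1
  rw [← Matrix.spectrum_toLin', ← Module.End.hasEigenvalue_iff_mem_spectrum] at h
  obtain ⟨x, hx⟩ := h.exists_hasEigenvector
  have h1 : ∀ u, ∑ v ∈ nbr G u, x v = lam G * x u := by
    intro u
    have := congrFun hx.apply_eq_smul u
    rw [Matrix.toLin'_apply, adjMatrix_mulVec_eq] at this
    simpa using this
  refine ⟨fun u => |x u|, fun u => abs_nonneg _, ?_, ?_⟩
  · intro h0
    apply hx.2
    ext u
    simpa using congrFun h0 u
  -- Taking absolute values keeps the norm and does not decrease the form, so `|x|` is again a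
  -- maximiser.
  · apply eigen_of_le_quad
    simp only [sq_abs]
    rw [← quad_eq_of_eigen h1]
    refine sum_le_sum fun u _ => sum_le_sum fun v _ => ?_
    rw [← abs_mul]
    exact le_abs_self _

lemma le_lam_of_le_quad {G : SimpleGraph α} {y : α → ℝ} {r : ℝ} (hy : y ≠ 0)
    (h : r * ∑ u, y u ^ 2 ≤ quad G y) : r ≤ lam G := by
  have h1 := h.trans (quad_le_lam G y)
  refine le_of_mul_le_mul_right h1 ?_
  obtain ⟨u, hu⟩ := Function.ne_iff.1 hy
  exact sum_pos' (fun _ _ => sq_nonneg _) ⟨u, mem_univ _, by simpa using sq_pos_of_ne_zero hu⟩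

lemma le_lam_of_supersolution {G : SimpleGraph α} {y : α → ℝ} {r : ℝ} (hy : y ≠ 0)
    (hy0 : ∀ u, 0 ≤ y u) (h : ∀ u, r * y u ≤ ∑ v ∈ nbr G u, y v) : r ≤ lam G := by
  refine le_lam_of_le_quad hy ?_
  rw [quad, mul_sum]
  refine sum_le_sum fun u _ => ?_
  rw [← mul_sum]
  nlinarith [h u, hy0 u]

lemma quad_comp_le {β : Type*} [Fintype β] {G : SimpleGraph α} {H : SimpleGraph β} (e : α ≃ β)
    (he : ∀ u v, G.Adj u v → H.Adj (e u) (e v)) {y : α → ℝ} (hy : ∀ u, 0 ≤ y u) :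
    quad G y ≤ quad H (y ∘ e.symm) := by
  classical
  rw [quad, quad, ← e.sum_comp]
  refine sum_le_sum fun u _ => ?_
  have h1 := sum_map (nbr G u) e.toEmbedding (fun v => (y ∘ e.symm) (e u) * (y ∘ e.symm) v)
  simp only [Equiv.coe_toEmbedding, Function.comp_apply, Equiv.symm_apply_apply] at h1
  rw [← h1]
  · simp only [Function.comp_apply, Equiv.symm_apply_apply]
    refine sum_le_sum_of_subset_of_nonneg ?_ fun v _ _ => mul_nonneg (hy _) (hy _)
    intro v
    simp only [mem_map, mem_nbr]
    rintro ⟨w, hw, rfl⟩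
    exact he _ _ hw

lemma lam_le_of_bijective_hom {β : Type*} [Fintype β] {G : SimpleGraph α} {H : SimpleGraph β}
    (e : α ≃ β) (he : ∀ u v, G.Adj u v → H.Adj (e u) (e v)) : lam G ≤ lam H := by
  rcases isEmpty_or_nonempty α with h | h
  · have : IsEmpty β := e.symm.isEmpty
    classical
    unfold lam
    simp only [spectrum.of_subsingleton, le_refl]
  obtain ⟨x, hx0, hx, hxe⟩ := exists_perron G
  refine le_lam_of_le_quad (y := x ∘ e.symm) ?_ ?_
  · intro h0
    apply hx
    ext u
    simpa using congrFun h0 (e u)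
  · refine le_trans (le_of_eq ?_) (quad_comp_le e he hx0)
    rw [quad_eq_of_eigen hxe]
    congr 1
    exact e.symm.sum_comp (fun u => x u ^ 2)

lemma lam_eq_of_iso {β : Type*} [Fintype β] {G : SimpleGraph α} {H : SimpleGraph β}
    (e : G ≃g H) : lam G = lam H :=
  le_antisymm (lam_le_of_bijective_hom e.toEquiv fun _ _ h => e.map_adj_iff.2 h)
    (lam_le_of_bijective_hom e.symm.toEquiv fun _ _ h => e.symm.map_adj_iff.2 h)

lemma lam_le_spex_fin {V : Type*} {n : ℕ} {F : SimpleGraph V} {G : SimpleGraph (Fin n)}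
    (hG : F.Free G) : lam G ≤ spex n F :=
  (isGreatest_spex n F ⟨G, hG⟩).2 ⟨G, hG, rfl⟩

lemma exists_iso_fin (G : SimpleGraph α) {n : ℕ} (hn : Fintype.card α = n) :
    ∃ H : SimpleGraph (Fin n), Nonempty (G ≃g H) := by
  let e := Fintype.equivFinOfCardEq hn
  exact ⟨G.map e.toEmbedding, ⟨SimpleGraph.Iso.map e G⟩⟩

lemma lam_le_spex {V : Type*} {n : ℕ} {F : SimpleGraph V} {G : SimpleGraph α}
    (hn : Fintype.card α = n) (hG : F.Free G) : lam G ≤ spex n F := by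
  obtain ⟨H, ⟨e⟩⟩ := exists_iso_fin G hn
  rw [lam_eq_of_iso e]
  refine lam_le_spex_fin fun h => hG ?_
  exact h.trans ⟨e.symm.toCopy⟩

/-! ### Trees, degeneracy and orientations -/

section Trees
variable {V : Type*} [Fintype V] [DecidableEq V] {T : SimpleGraph V}

/-- In a vertex of `S` furthest from a root `r ∈ S`, every neighbour in `S` is closer to `r`, hence
is the penultimate vertex of the unique path from `r`. All later inductions on subsets of a tree
remove such a vertex. -/
lemma exists_card_nbr_inter_le_one (hT : T.IsTree) {S : Finset V} (hS : S.Nonempty) :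
    ∃ v ∈ S, (nbr T v ∩ S).card ≤ 1 := by
  obtain ⟨r, hr⟩ := hS
  obtain ⟨v, hv, hmax⟩ := S.exists_max_image (fun v => T.dist r v) ⟨r, hr⟩
  refine ⟨v, hv, card_le_one.2 ?_⟩
  have key : ∀ a ∈ nbr T v ∩ S, ∃ p : T.Walk r v, p.IsPath ∧ p.penultimate = a := by
    intro a ha
    rw [mem_inter, mem_nbr] at ha
    have hd := hT.dist_eq_dist_add_one_of_adj r ha.1
    have := hmax a ha.2
    obtain ⟨p, hp⟩ := hT.connected.exists_walk_length_eq_dist r a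
    refine ⟨p.concat ha.1.symm, ?_, by simp⟩
    apply SimpleGraph.Walk.isPath_of_length_eq_dist
    rw [SimpleGraph.Walk.length_concat, hp]
    omega
  intro a ha b hb
  obtain ⟨p, hp, rfl⟩ := key a ha
  obtain ⟨q, hq, rfl⟩ := key b hb
  rw [Subtype.mk.inj ((hT.isAcyclic.subsingleton_path r v).elim ⟨p, hp⟩ ⟨q, hq⟩)]

end Trees

section
variable {α : Type*} [Fintype α] [DecidableEq α]

lemma sum_card_nbr_inter_erase (G : SimpleGraph α) {S : Finset α} {v : α} (hv : v ∈ S) :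
    ∑ u ∈ S, (nbr G u ∩ S).card
      = ∑ u ∈ S.erase v, (nbr G u ∩ S.erase v).card + 2 * (nbr G v ∩ S).card := by
  rw [← add_sum_erase S _ hv]
  have h1 : ∀ u ∈ S.erase v, (nbr G u ∩ S).card
      = (nbr G u ∩ S.erase v).card + if u ∈ nbr G v ∩ S then 1 else 0 := by
    intro u hu
    have huS := mem_of_mem_erase hu
    rw [inter_erase]
    by_cases h : G.Adj v u
    · have : v ∈ nbr G u ∩ S := by simp [h.symm, hv]
      rw [if_pos (by simp [h, huS]), card_erase_add_one this]
    · have : v ∉ nbr G u ∩ S := by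
        simp only [mem_inter, mem_nbr]
        exact fun h' => h h'.1.symm
      rw [if_neg (by simp [h]), erase_eq_of_notMem this, add_zero]
  rw [sum_congr rfl h1, sum_add_distrib, sum_ite_mem, sum_const, smul_eq_mul, mul_one]
  have : S.erase v ∩ (nbr G v ∩ S) = nbr G v ∩ S := by
    ext u
    simp only [mem_inter, mem_erase, mem_nbr]
    constructor
    · tauto
    · rintro ⟨h, h'⟩
      exact ⟨⟨h.ne', h'⟩, h, h'⟩
  rw [this]
  ring

lemma sum_card_nbr_inter_le {G : SimpleGraph α} {k : ℕ}
    (h : ∀ S : Finset α, S.Nonempty → ∃ v ∈ S, (nbr G v ∩ S).card ≤ k) (S : Finset α) :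
    ∑ u ∈ S, (nbr G u ∩ S).card ≤ 2 * k * S.card := by
  induction S using Finset.strongInduction with
  | H S ih =>
    rcases S.eq_empty_or_nonempty with rfl | hS
    · simp
    obtain ⟨v, hv, hk⟩ := h S hS
    rw [sum_card_nbr_inter_erase G hv]
    have := ih _ (erase_ssubset hv)
    have h2 := card_erase_add_one hv
    rw [← h2, mul_add]
    nlinarith

/-- A `k`-degenerate graph has an orientation with out-degrees at most `k`. -/
lemma exists_orientation {G : SimpleGraph α} {k : ℕ}
    (h : ∀ S : Finset α, S.Nonempty → ∃ v ∈ S, (nbr G v ∩ S).card ≤ k) :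
    ∃ out : α → Finset α, (∀ u, (out u).card ≤ k) ∧ (∀ u, out u ⊆ nbr G u) ∧
      ∀ u v, G.Adj u v → v ∈ out u ∨ u ∈ out v := by
  have key : ∀ S : Finset α, ∃ out : α → Finset α, (∀ u, (out u).card ≤ k) ∧
      (∀ u, out u ⊆ nbr G u) ∧ ∀ u ∈ S, ∀ v ∈ S, G.Adj u v → v ∈ out u ∨ u ∈ out v := by
    intro S
    induction S using Finset.strongInduction with
    | H S ih =>
      rcases S.eq_empty_or_nonempty with rfl | hS
      · exact ⟨fun _ => ∅, by simp, by simp, by simp⟩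
      obtain ⟨v, hv, hk⟩ := h S hS
      obtain ⟨out, h1, h2, h3⟩ := ih _ (erase_ssubset hv)
      -- The removed vertex `v` points to all its neighbours in `S`; the other edges inside `S` are
      -- already oriented.
      refine ⟨Function.update out v (nbr G v ∩ S), ?_, ?_, ?_⟩
      · intro u
        rcases eq_or_ne u v with rfl | hu
        · simpa using hk
        · simpa [hu] using h1 u
      · intro u
        rcases eq_or_ne u v with rfl | hu
        · simp
        · simpa [hu] using h2 u
      · intro a ha b hb hab
        rcases eq_or_ne a v with rfl | hav
        · left; simp [hab, hb]
        rcases eq_or_ne b v with rfl | hbv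
        · right; simp [hab.symm, ha]
        simpa [hav, hbv] using h3 a (mem_erase.2 ⟨hav, ha⟩) b (mem_erase.2 ⟨hbv, hb⟩) hab
  obtain ⟨out, h1, h2, h3⟩ := key univ
  exact ⟨out, h1, h2, fun u v => h3 u (mem_univ _) v (mem_univ _)⟩

end

section Trees
variable {V : Type*} [Fintype V] [DecidableEq V] {T : SimpleGraph V}

lemma sum_card_nbr_inter_le_of_isTree (hT : T.IsTree) {S : Finset V} (hS : S.Nonempty) :
    ∑ u ∈ S, (nbr T u ∩ S).card + 2 ≤ 2 * S.card := by
  induction S using Finset.strongInduction with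
  | H S ih =>
    obtain ⟨v, hv, hk⟩ := exists_card_nbr_inter_le_one hT hS
    rw [sum_card_nbr_inter_erase T hv]
    have h2 := card_erase_add_one hv
    rcases (S.erase v).eq_empty_or_nonempty with h0 | h0
    · have : nbr T v ∩ S = ∅ := by
        rw [← not_nonempty_iff_eq_empty]
        rintro ⟨w, hw⟩
        rw [mem_inter, mem_nbr] at hw
        have : w ∈ S.erase v := mem_erase.2 ⟨hw.1.ne', hw.2⟩
        simp [h0] at this
      rw [h0] at h2 ⊢
      rw [this]
      simp at h2 ⊢
      omega
    · have := ih _ (erase_ssubset hv) h0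
      omega

/-- Greedy embedding: put the removed vertices back one at a time. A new vertex has at most one
neighbour already placed, and the image of that neighbour has more neighbours in `S` than have been
used. -/
lemma isContained_of_forall_le_card_nbr_inter {α : Type*} [Fintype α] [DecidableEq α]
    {G : SimpleGraph α} (hT : T.IsTree) {S : Finset α} (hS : S.Nonempty)
    (h : ∀ v ∈ S, Fintype.card V ≤ (nbr G v ∩ S).card) : T.IsContained G := by
  have hcard : Fintype.card V ≤ S.card := by
    obtain ⟨v, hv⟩ := hS
    exact (h v hv).trans (card_le_card inter_subset_right)
  have key : ∀ A : Finset V, ∃ φ : V → α, (∀ a ∈ A, φ a ∈ S) ∧ Set.InjOn φ A ∧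
      ∀ a ∈ A, ∀ b ∈ A, T.Adj a b → G.Adj (φ a) (φ b) := by
    intro A
    induction A using Finset.strongInduction with
    | H A ih =>
      rcases A.eq_empty_or_nonempty with rfl | hA
      · obtain ⟨v, -⟩ := hS
        exact ⟨fun _ => v, by simp, by simp, by simp⟩
      obtain ⟨a, ha, h1⟩ := exists_card_nbr_inter_le_one hT hA
      obtain ⟨φ, hφS, hφi, hφa⟩ := ih _ (erase_ssubset ha)
      have him : ((A.erase a).image φ).card < Fintype.card V := by
        refine card_image_le.trans_lt ?_
        have := card_erase_add_one ha
        have := card_le_univ A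
        omega
      obtain ⟨w, hwS, hwi, hwa⟩ : ∃ w ∈ S, w ∉ (A.erase a).image φ ∧
          ∀ b ∈ A, T.Adj a b → G.Adj w (φ b) := by
        rcases (nbr T a ∩ A).eq_empty_or_nonempty with h0 | ⟨b, hb⟩
        · obtain ⟨w, hw, hwi⟩ := exists_mem_notMem_of_card_lt_card (him.trans_le hcard)
          refine ⟨w, hw, hwi, fun b hb hab => ?_⟩
          have : b ∈ nbr T a ∩ A := by simp [hb, hab]
          simp [h0] at this
        · have hb' := hb
          rw [mem_inter, mem_nbr] at hb'
          have hbA : b ∈ A.erase a := mem_erase.2 ⟨hb'.1.ne', hb'.2⟩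
          obtain ⟨w, hw, hwi⟩ :=
            exists_mem_notMem_of_card_lt_card (him.trans_le (h _ (hφS b hbA)))
          rw [mem_inter, mem_nbr] at hw
          refine ⟨w, hw.2, hwi, fun c hc hac => ?_⟩
          have : c = b := card_le_one.1 h1 c (by simp [hc, hac]) b hb
          rw [this]
          exact hw.1.symm
      have hne : ∀ b ∈ A.erase a, φ b ≠ w := fun b hb he => hwi (mem_image.2 ⟨b, hb, he⟩)
      refine ⟨Function.update φ a w, ?_, ?_, ?_⟩
      · intro b hb
        rcases eq_or_ne b a with rfl | hba
        · simpa using hwS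
        · simpa [hba] using hφS b (mem_erase.2 ⟨hba, hb⟩)
      · intro b hb c hc hbc
        by_cases hba : b = a <;> by_cases hca : c = a
        · rw [hba, hca]
        · rw [hba] at hbc
          simp only [Function.update_self, Function.update_of_ne hca] at hbc
          exact absurd hbc.symm (hne c (mem_erase.2 ⟨hca, hc⟩))
        · rw [hca] at hbc
          simp only [Function.update_self, Function.update_of_ne hba] at hbc
          exact absurd hbc (hne b (mem_erase.2 ⟨hba, hb⟩))
        · simp only [Function.update_of_ne hba, Function.update_of_ne hca] at hbc
          exact hφi (by simpa [hba] using hb) (by simpa [hca] using hc) hbc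
      · intro b hb c hc hbc
        by_cases hba : b = a <;> by_cases hca : c = a
        · rw [hba, hca] at hbc
          exact absurd hbc T.irrefl
        · rw [hba] at hbc ⊢
          simpa [hca] using hwa c hc hbc
        · rw [hca] at hbc ⊢
          simpa [hba] using (hwa b hb hbc.symm).symm
        · simpa [hba, hca] using
            hφa b (mem_erase.2 ⟨hba, hb⟩) c (mem_erase.2 ⟨hca, hc⟩) hbc
  obtain ⟨φ, -, hi, ha⟩ := key univ
  exact ⟨⟨⟨φ, fun h => ha _ (mem_univ _) _ (mem_univ _) h⟩,
    fun a b hab => hi (mem_coe.2 (mem_univ _)) (mem_coe.2 (mem_univ _)) hab⟩⟩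

lemma degenerate_of_free {α : Type*} [Fintype α] [DecidableEq α]
    {G : SimpleGraph α} (hT : T.IsTree) (hG : T.Free G) (S : Finset α) (hS : S.Nonempty) :
    ∃ v ∈ S, (nbr G v ∩ S).card ≤ Fintype.card V := by
  by_contra! h
  exact hG (isContained_of_forall_le_card_nbr_inter hT hS fun v hv => (h v hv).le)

end Trees

/-! ### Copies of the tree in joins -/

/-- `A` is the smaller colour class of a bipartite graph `T`: it has `l + 1` vertices, at most as
many as its complement, and `δ` is the minimum degree of its vertices. -/
structure IsHalf {V : Type*} [Fintype V] [DecidableEq V] (T : SimpleGraph V) (A : Finset V)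
    (l δ : ℕ) : Prop where
  card_eq : A.card = l + 1
  le_card_compl : l + 1 ≤ Aᶜ.card
  mem_iff : ∀ ⦃u v⦄, T.Adj u v → (u ∈ A ↔ v ∉ A)
  le_card_nbr : ∀ a ∈ A, δ ≤ (nbr T a).card
  exists_card_nbr : ∃ a ∈ A, (nbr T a).card = δ

lemma exists_injOn_of_card_le {β α : Type*} [Nonempty α] {s : Finset β} {t : Finset α}
    (h : s.card ≤ t.card) : ∃ f : β → α, (∀ x ∈ s, f x ∈ t) ∧ Set.InjOn f s := by
  classical
  obtain ⟨e⟩ : Nonempty (s ↪ t) := Function.Embedding.nonempty_of_card_le (by simpa using h)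
  refine ⟨fun x => if hx : x ∈ s then e ⟨x, hx⟩ else Classical.arbitrary α, ?_, ?_⟩
  · intro x hx
    simp [hx]
  · intro x hx y hy hxy
    rw [mem_coe] at hx hy
    simp only [hx, hy, dif_pos] at hxy
    simpa using e.injective (Subtype.ext hxy)

lemma isContained_of_injective {V α : Type*} {T : SimpleGraph V} {G : SimpleGraph α} (φ : V → α)
    (hi : Function.Injective φ) (ha : ∀ u v, T.Adj u v → G.Adj (φ u) (φ v)) : T.IsContained G :=
  ⟨⟨⟨φ, fun h => ha _ _ h⟩, hi⟩⟩

section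
variable {V : Type*} [Fintype V] [DecidableEq V] {T : SimpleGraph V} {A : Finset V} {l δ : ℕ}

lemma TreeFamily.exists_isHalf {m : ℕ} (h : TreeFamily m (l + 1) δ T) :
    T.IsTree ∧ Fintype.card V = m ∧ ∃ A, IsHalf T A l δ := by
  obtain ⟨hT, hm, A, B, hb, hu, hle, hc, hδ⟩ := h
  have hdeg : ∀ (v : V) (i : Fintype (T.neighborSet v)), (nbr T v).card = T.degree v := by
    intro v i
    rw [← SimpleGraph.card_neighborFinset_eq_degree]
    congr 1
    ext
    simp
  have hB : Aᶜ = B := by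
    ext v
    have hd := hb.disjoint
    rw [disjoint_coe] at hd
    have := Finset.mem_univ v
    rw [← hu] at this
    have := (@Finset.mem_union _ (fun a b => Classical.propDecidable (a = b)) A B v).1 this
    rw [mem_compl]
    constructor
    · tauto
    · intro hv hvA
      exact disjoint_left.1 hd hvA hv
  refine ⟨hT, hm, A, hc, by rw [hB, ← hc]; exact hle, ?_, ?_, ?_⟩
  · intro u v huv
    rw [← mem_compl, hB]
    rcases hb.mem_of_adj huv with ⟨h1, h2⟩ | ⟨h1, h2⟩
    · simp only [mem_coe] at h1 h2
      simp [h1, h2]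
    · simp only [mem_coe] at h1 h2
      rw [← hB, mem_compl] at h1
      have h3 : v ∉ B := by rw [← hB]; simpa using h2
      simp [h1, h3]
  · intro a ha
    exact (hδ.2 ⟨a, ha, rfl⟩).trans (hdeg a _).ge
  · obtain ⟨a, ha, hd⟩ := hδ.1
    exact ⟨a, ha, (hdeg a _).trans hd⟩

/-- Deleting at most `l` vertices from `T` leaves a vertex of degree at least `δ` or two vertices
of degree at least `δ - 1`. -/
lemma IsHalf.exists_card_nbr_sdiff (hT : T.IsTree) (hA : IsHalf T A l δ) {X : Finset V}
    (hX : X.card ≤ l) :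
    (∃ a ∉ X, δ ≤ (nbr T a \ X).card) ∨
      ∃ a ∉ X, ∃ b ∉ X, a ≠ b ∧ a ∈ A ∧ b ∈ A ∧ δ ≤ (nbr T a \ X).card + 1 ∧
        δ ≤ (nbr T b \ X).card + 1 := by
  by_contra! hcon
  obtain ⟨hc1, hc2⟩ := hcon
  have e1 := card_sdiff_add_card_inter A X
  have e2 := card_sdiff_add_card_inter X A
  rw [inter_comm] at e2
  have e3 := hA.card_eq
  -- The neighbours of `a ∈ A` lie outside `A`, so deleting `X` only costs `a` its neighbours in `X
  -- \ A`.
  have hsplit : ∀ a ∈ A \ X, δ ≤ (nbr T a \ X).card + (nbr T a ∩ (X \ A)).card := by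
    intro a ha
    rw [mem_sdiff] at ha
    have h1 := card_sdiff_add_card_inter (nbr T a) X
    have h2 : nbr T a ∩ X = nbr T a ∩ (X \ A) := by
      ext u
      simp only [mem_inter, mem_sdiff, mem_nbr]
      constructor
      · rintro ⟨h, h'⟩
        exact ⟨h, h', (hA.mem_iff h).1 ha.1⟩
      · tauto
    rw [← h2, h1]
    exact hA.le_card_nbr a ha.1
  have hge1 : ∀ a ∈ A \ X, 1 ≤ (nbr T a ∩ (X \ A)).card := by
    intro a ha
    have := hsplit a ha
    have := hc1 a (mem_sdiff.1 ha).2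
    omega
  have hne : (A \ X).Nonempty := card_pos.1 (by omega)
  -- If both alternatives fail, every vertex of `A \ X` loses a neighbour, and all but at most one
  -- of them lose two.
  have hsum : 2 * (A \ X).card ≤ ∑ a ∈ A \ X, (nbr T a ∩ (X \ A)).card + 1 := by
    by_cases hall : ∀ a ∈ A \ X, 2 ≤ (nbr T a ∩ (X \ A)).card
    · have := card_nsmul_le_sum _ _ 2 hall
      rw [smul_eq_mul] at this
      omega
    · push Not at hall
      obtain ⟨a, ha, hlt⟩ := hall
      have h2 : ∀ b ∈ (A \ X).erase a, 2 ≤ (nbr T b ∩ (X \ A)).card := by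
        intro b hb
        rw [mem_erase] at hb
        by_contra! hb2
        have h3 := hsplit a ha
        have h4 := hsplit b hb.2
        rw [mem_sdiff] at ha hb
        have := hc2 a ha.2 b hb.2.2 hb.1.symm ha.1 hb.2.1 (by omega)
        omega
      have h5 := card_nsmul_le_sum _ _ 2 h2
      rw [smul_eq_mul] at h5
      rw [← add_sum_erase _ _ ha]
      have h6 := card_erase_add_one ha
      have := hge1 a ha
      omega
  have hdisj : Disjoint (A \ X) (X \ A) := by
    rw [disjoint_left]
    intro u
    simp only [mem_sdiff]
    tauto
  -- Since `|X| < |A|`, also `|X \ A| < |A \ X|`, so a forest on these two sets has at most `2|A \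
  -- X| - 2` edges, one fewer than `hsum` demands.
  have hforest := sum_card_nbr_inter_le_of_isTree hT (S := (A \ X) ∪ (X \ A))
    (hne.mono subset_union_left)
  rw [sum_union hdisj, card_union_of_disjoint hdisj] at hforest
  have h1 : ∑ a ∈ A \ X, (nbr T a ∩ (X \ A)).card
      ≤ ∑ a ∈ A \ X, (nbr T a ∩ ((A \ X) ∪ (X \ A))).card :=
    sum_le_sum fun a _ => card_le_card (inter_subset_inter_left subset_union_right)
  have h2 : ∑ a ∈ X \ A, (nbr T a ∩ (A \ X)).card
      ≤ ∑ a ∈ X \ A, (nbr T a ∩ ((A \ X) ∪ (X \ A))).card :=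
    sum_le_sum fun a _ => card_le_card (inter_subset_inter_left subset_union_left)
  have h3 : ∑ a ∈ A \ X, (nbr T a ∩ (X \ A)).card = ∑ a ∈ X \ A, (nbr T a ∩ (A \ X)).card := by
    have := sum_card_bipartiteAbove_eq_sum_card_bipartiteBelow (s := A \ X) (t := X \ A)
      (fun a b => b ∈ nbr T a)
    convert this using 2
    · congr 1
      ext; simp [bipartiteAbove, and_comm]
    · congr 1
      ext; simp [bipartiteBelow, SimpleGraph.adj_comm, and_comm]
  omega

lemma join_adj_inl_inl {ι β : Type*} {G : SimpleGraph ι} {H : SimpleGraph β} {a b : ι} :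
    (join G H).Adj (Sum.inl a) (Sum.inl b) ↔ G.Adj a b := by simp [join]

lemma join_adj_inr_inr {ι β : Type*} {G : SimpleGraph ι} {H : SimpleGraph β} {a b : β} :
    (join G H).Adj (Sum.inr a) (Sum.inr b) ↔ H.Adj a b := by simp [join]

lemma join_adj_inl_inr {ι β : Type*} {G : SimpleGraph ι} {H : SimpleGraph β} {a : ι} {b : β} :
    (join G H).Adj (Sum.inl a) (Sum.inr b) := by simp [join]

lemma join_adj_inr_inl {ι β : Type*} {G : SimpleGraph ι} {H : SimpleGraph β} {a : ι} {b : β} :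
    (join G H).Adj (Sum.inr b) (Sum.inl a) := by simp [join]

lemma card_filter_isLeft_le {V ι β : Type*} [Fintype V] [Fintype ι] {T : SimpleGraph V}
    {G : SimpleGraph ι} {H : SimpleGraph β} (φ : T.Copy (join G H)) :
    (univ.filter fun v => (φ v).isLeft).card ≤ Fintype.card ι := by
  rw [← Finset.card_univ, ← card_map (s := univ) (Function.Embedding.inl (β := β)),
    ← card_map φ.toEmbedding]
  refine card_le_card fun u hu => ?_
  simp only [mem_map, mem_filter] at hu
  obtain ⟨v, ⟨-, hv⟩, rfl⟩ := hu
  obtain ⟨i, hi⟩ := Sum.isLeft_iff.1 hv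
  simp only [mem_map, mem_univ, true_and]
  exact ⟨i, hi.symm⟩

/-- Delete from `T` the vertices that a copy sends to the left side; the rest embeds in `H`. The
clause `1 ≤ l` records that two vertices of `A` were found; it serves to rule out `l = 0`. -/
lemma exists_card_nbr_of_isContained_join {ι β : Type*} [Fintype ι] [Fintype β]
    {G : SimpleGraph ι} {H : SimpleGraph β} (hT : T.IsTree) (hA : IsHalf T A l δ)
    (hι : Fintype.card ι ≤ l) (h : T.IsContained (join G H)) :
    (∃ w, δ ≤ (nbr H w).card) ∨ ∃ w w', w ≠ w' ∧ δ ≤ (nbr H w).card + 1 ∧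
      δ ≤ (nbr H w').card + 1 ∧ 1 ≤ l := by
  classical
  obtain ⟨φ⟩ := h
  let X : Finset V := univ.filter fun v => (φ v).isLeft
  have hX : X.card ≤ Fintype.card ι := card_filter_isLeft_le φ
  have hout : ∀ v ∉ X, ∃ w, φ v = Sum.inr w := by
    intro v hv
    apply Sum.isRight_iff.1
    simpa [X] using hv
  have hcard : ∀ a ∉ X, ∀ w, φ a = Sum.inr w → (nbr T a \ X).card ≤ (nbr H w).card := by
    intro a ha w hw
    rw [← card_map φ.toEmbedding, ← card_map (s := nbr H w) (Function.Embedding.inr (α := ι))]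
    refine card_le_card fun u hu => ?_
    simp only [mem_map, mem_sdiff, mem_nbr] at hu ⊢
    obtain ⟨v, ⟨hav, hvX⟩, rfl⟩ := hu
    obtain ⟨w', hw'⟩ := hout v hvX
    refine ⟨w', ?_, hw'.symm⟩
    have : (join G H).Adj (φ a) (φ v) := φ.toHom.map_adj hav
    rwa [hw, hw', join_adj_inr_inr] at this
  rcases hA.exists_card_nbr_sdiff hT (hX.trans hι) with ⟨a, ha, hd⟩ |
    ⟨a, ha, b, hb, hab, haA, hbA, hda, hdb⟩
  · obtain ⟨w, hw⟩ := hout a ha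
    exact Or.inl ⟨w, hd.trans (hcard a ha w hw)⟩
  · obtain ⟨w, hw⟩ := hout a ha
    obtain ⟨w', hw'⟩ := hout b hb
    have h1 := hcard a ha w hw
    have h2 := hcard b hb w' hw'
    refine Or.inr ⟨w, w', ?_, by omega, by omega, ?_⟩
    · rintro rfl
      exact hab (φ.injective (hw.trans hw'.symm))
    · have := one_lt_card.2 ⟨a, haA, b, hbA, hab⟩
      have := hA.card_eq
      omega

lemma free_join {ι β : Type*} [Fintype ι] [Fintype β]
    {G : SimpleGraph ι} {H : SimpleGraph β} (hT : T.IsTree) (hA : IsHalf T A l δ)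
    (hι : Fintype.card ι ≤ l) (h1 : ∀ w, (nbr H w).card < δ)
    (h2 : ∀ w w', δ ≤ (nbr H w).card + 1 → δ ≤ (nbr H w').card + 1 → w = w') :
    T.Free (join G H) := by
  intro h
  rcases exists_card_nbr_of_isContained_join hT hA hι h with ⟨w, hw⟩ | ⟨w, w', hne, hw, hw', -⟩
  · exact (h1 w).not_ge hw
  · exact hne (h2 w w' hw hw')

lemma card_nbr_copies_star_le (m δ : ℕ) (hδ : 2 ≤ δ) (p : Fin m × (Fin 1 ⊕ Fin (δ - 1))) :
    (nbr (copies m (star δ)) p).card < δ := by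
  obtain ⟨i, j | j⟩ := p
  · have : nbr (copies m (star δ)) (i, Sum.inl j)
        ⊆ univ.image fun k : Fin (δ - 1) => (i, Sum.inr k) := by
      rintro ⟨a, b | b⟩ h
      · simp [copies, star] at h
      · simp only [mem_nbr, copies] at h
        simp [h.1]
    have := (card_le_card this).trans card_image_le
    simp only [card_univ, Fintype.card_fin] at this
    omega
  · have : nbr (copies m (star δ)) (i, Sum.inr j) ⊆ {(i, Sum.inl 0)} := by
      rintro ⟨a, b | b⟩ h
      · simp only [mem_nbr, copies] at h
        simp [h.1, Subsingleton.elim b 0]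
      · simp [copies, star] at h
    have := card_le_card this
    rw [card_singleton] at this
    omega

/-- For `δ ≤ 1` the stars have no edges, so the host is bipartite with a class of size `l`. A
connected graph has only one bipartition, and both classes of `T` have more than `l` vertices. -/
lemma two_le_of_isContained {m : ℕ} (hT : T.IsTree) (hA : IsHalf T A l δ)
    (h : T.IsContained (join (⊥ : SimpleGraph (Fin l)) (copies m (star δ)))) : 2 ≤ δ := by
  by_contra! hδ
  obtain ⟨φ⟩ := h
  let X : Finset V := univ.filter fun v => (φ v).isLeft
  have hX : X.card ≤ l := (card_filter_isLeft_le φ).trans_eq (Fintype.card_fin l)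
  -- Along an edge, membership in `A` and membership in `X` both flip, so whether they agree is
  -- invariant.
  have hflip : ∀ u v, T.Adj u v → ((u ∈ A ↔ u ∈ X) ↔ (v ∈ A ↔ v ∈ X)) := by
    intro u v huv
    have h1 := hA.mem_iff huv
    have h2 : u ∈ X ↔ v ∉ X := by
      have hadj : (join (⊥ : SimpleGraph (Fin l)) (copies m (star δ))).Adj (φ u) (φ v) :=
        φ.toHom.map_adj huv
      have hempty : IsEmpty (Fin (δ - 1)) := by
        rw [show δ - 1 = 0 by omega]; infer_instance
      have hstar : ∀ p q : Fin 1 ⊕ Fin (δ - 1), ¬ (star δ).Adj p q := by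
        rintro (p | p) (q | q)
        · simp [star]
        · exact hempty.elim q
        · exact hempty.elim p
        · exact hempty.elim p
      simp only [X, mem_filter, mem_univ, true_and]
      rcases h1 : φ u with i | i <;> rcases h2 : φ v with j | j <;> rw [h1, h2] at hadj
      · rw [join_adj_inl_inl] at hadj
        exact hadj.elim
      · simp
      · simp
      · rw [join_adj_inr_inr] at hadj
        exact absurd hadj.2 (hstar _ _)
    tauto
  obtain ⟨r, hr⟩ : A.Nonempty := card_pos.1 (by rw [hA.card_eq]; omega)
  have hconst : ∀ v, (r ∈ A ↔ r ∈ X) ↔ (v ∈ A ↔ v ∈ X) := by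
    intro v
    have key : ∀ a b (p : T.Walk a b), (a ∈ A ↔ a ∈ X) ↔ (b ∈ A ↔ b ∈ X) := by
      intro a b p
      induction p with
      | nil => rfl
      | cons h p ih => exact (hflip _ _ h).trans ih
    obtain ⟨p⟩ := hT.connected r v
    exact key r v p
  by_cases hrX : r ∈ X
  · have : A ⊆ X := fun v hv => ((hconst v).1 (by simp [hr, hrX])).1 hv
    have := card_le_card this
    have := hA.card_eq
    omega
  · have : Aᶜ ⊆ X := fun v hv => by
      have := hconst v
      simp only [mem_compl] at hv
      tauto
    have := card_le_card this
    have := hA.le_card_compl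
    omega

lemma one_le_of_isContained {m : ℕ} (hT : T.IsTree) (hA : IsHalf T A l δ)
    (h : T.IsContained (join (⊥ : SimpleGraph (Fin l)) (copies m (star δ)))) : 1 ≤ l := by
  have hδ := two_le_of_isContained hT hA h
  rcases exists_card_nbr_of_isContained_join hT hA (by simp) h with ⟨w, hw⟩ | ⟨w, w', -, -, -, h⟩
  · exact absurd hw (card_nbr_copies_star_le m δ hδ w).not_ge
  · exact h

/-- If `l` vertices are joined to a large set `R` and a further vertex has `δ` neighbours in `R`,
then the graph contains `T`. -/
lemma isContained_of_hub {α : Type*} [Fintype α] [DecidableEq α] {G : SimpleGraph α}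
    (hA : IsHalf T A l δ) {L R : Finset α} {v : α} (hL : L.card = l) (hv : v ∉ L)
    (hLR : ∀ w ∈ L, ∀ r ∈ R, G.Adj w r) (hd : δ ≤ (nbr G v ∩ R).card)
    (hR : Fintype.card V + 1 ≤ R.card) : T.IsContained G := by
  classical
  have : Nonempty α := ⟨v⟩
  -- A vertex `a ∈ A` of degree exactly `δ` goes to `v`, the rest of `A` to `L`, the neighbours of
  -- `a` to neighbours of `v` in `R`, and everything else to the unused part of `R`. As `v` may lie
  -- in `R`, it is erased there, which is why `R` needs one extra element.
  obtain ⟨a, ha, hda⟩ := hA.exists_card_nbr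
  obtain ⟨f, hfL, hfi⟩ := exists_injOn_of_card_le (s := A.erase a) (t := L)
    (by rw [card_erase_of_mem ha, hA.card_eq, hL]; omega)
  obtain ⟨g, hgR, hgi⟩ := exists_injOn_of_card_le (s := nbr T a) (t := nbr G v ∩ R)
    (by rw [hda]; exact hd)
  obtain ⟨k, hkR, hki⟩ := exists_injOn_of_card_le (s := Aᶜ \ nbr T a)
    (t := R.erase v \ (nbr T a).image g) (by
      have h1 : (nbr T a) ⊆ Aᶜ := fun u hu => by
        rw [mem_compl]
        exact (hA.mem_iff (mem_nbr.1 hu)).1 ha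
      rw [card_sdiff_of_subset h1]
      have h2 := le_card_sdiff ((nbr T a).image g) (R.erase v)
      have h3 : ((nbr T a).image g).card ≤ (nbr T a).card := card_image_le
      have h4 := pred_card_le_card_erase (s := R) (a := v)
      have h5 := card_le_univ Aᶜ
      omega)
  have hdisj : ∀ u ∈ L, u ∉ R := fun u h1 h2 => G.irrefl (hLR u h1 u h2)
  have hfL' : ∀ x, x ≠ a → x ∈ A → f x ∈ L := fun x h1 h2 => hfL x (mem_erase.2 ⟨h1, h2⟩)
  have hgR' : ∀ x, T.Adj a x → G.Adj v (g x) ∧ g x ∈ R := fun x hx => by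
    simpa using hgR x (mem_nbr.2 hx)
  have hkR' : ∀ x, x ∉ A → ¬ T.Adj a x → k x ≠ v ∧ k x ∈ R ∧ ∀ y, T.Adj a y → g y ≠ k x :=
    fun x h1 h2 => by
      have := hkR x (by simp [h1, h2])
      simpa [and_assoc] using this
  let φ : V → α := fun u => if u = a then v else if u ∈ A then f u else
    if T.Adj a u then g u else k u
  have hφa : φ a = v := by simp [φ]
  have hφf : ∀ x, x ≠ a → x ∈ A → φ x = f x := fun x h1 h2 => by simp [φ, h1, h2]
  have hφg : ∀ x, T.Adj a x → φ x = g x := fun x h1 => by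
    have := (hA.mem_iff h1).1 ha
    simp [φ, h1, h1.ne', this]
  have hφk : ∀ x, x ∉ A → ¬ T.Adj a x → φ x = k x := fun x h1 h2 => by
    have : x ≠ a := by rintro rfl; exact h1 ha
    simp [φ, h1, h2, this]
  have hcase : ∀ x, (x = a ∧ φ x = v) ∨ (x ≠ a ∧ x ∈ A ∧ φ x = f x) ∨
      (T.Adj a x ∧ φ x = g x) ∨ (x ∉ A ∧ ¬ T.Adj a x ∧ φ x = k x) := by
    intro x
    by_cases h1 : x = a
    · subst h1; exact Or.inl ⟨rfl, hφa⟩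
    by_cases h2 : x ∈ A
    · exact Or.inr (Or.inl ⟨h1, h2, hφf x h1 h2⟩)
    by_cases h3 : T.Adj a x
    · exact Or.inr (Or.inr (Or.inl ⟨h3, hφg x h3⟩))
    · exact Or.inr (Or.inr (Or.inr ⟨h2, h3, hφk x h2 h3⟩))
  have hfi' : ∀ x y, x ≠ a → x ∈ A → y ≠ a → y ∈ A → f x = f y → x = y :=
    fun x y h1 h2 h3 h4 h => hfi (by simp [h1, h2]) (by simp [h3, h4]) h
  have hgi' : ∀ x y, T.Adj a x → T.Adj a y → g x = g y → x = y :=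
    fun x y h1 h2 h => hgi (by simpa using h1) (by simpa using h2) h
  have hki' : ∀ x y, x ∉ A → ¬ T.Adj a x → y ∉ A → ¬ T.Adj a y → k x = k y → x = y :=
    fun x y h1 h2 h3 h4 h => hki (by simp [h1, h2]) (by simp [h3, h4]) h
  have hnv : ∀ x, T.Adj a x → g x ≠ v := fun x hx h => (hgR' x hx).1.ne h.symm
  refine isContained_of_injective φ ?_ ?_
  · intro x y hxy
    rcases hcase x with ⟨h1, h2⟩ | ⟨h1, h1', h2⟩ | ⟨h1, h2⟩ | ⟨h1, h1', h2⟩ <;>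
    rcases hcase y with ⟨h3, h4⟩ | ⟨h3, h3', h4⟩ | ⟨h3, h4⟩ | ⟨h3, h3', h4⟩ <;>
    rw [h2, h4] at hxy <;> grind
  · have key : ∀ x y, x ∈ A → T.Adj x y → G.Adj (φ x) (φ y) := by
      intro x y hx hxy
      have hy := (hA.mem_iff hxy).1 hx
      by_cases hxa : x = a
      · subst hxa
        rw [hφa, hφg y hxy]
        exact (hgR' y hxy).1
      · rw [hφf x hxa hx]
        apply hLR _ (hfL' x hxa hx)
        by_cases h : T.Adj a y
        · rw [hφg y h]; exact (hgR' y h).2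
        · rw [hφk y hy h]; exact (hkR' y hy h).2.1
    intro x y hxy
    by_cases hx : x ∈ A
    · exact key x y hx hxy
    · refine (key y x ?_ hxy.symm).symm
      by_contra hy
      exact hx ((hA.mem_iff hxy).2 hy)

end

/-! ### Packing disjoint stars -/

section
variable {β : Type*} [Fintype β] [DecidableEq β] {H : SimpleGraph β} {k : ℕ}

/-- Closed neighbourhoods meet only at distance at most 2, and such a ball has at most `1 + k + k(k
- 1) = k² + 1` vertices. -/
lemma card_filter_not_disjoint_closed_nbr_le (hH : ∀ v, (nbr H v).card ≤ k) (p : β) :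
    (univ.filter fun q => ¬ Disjoint (insert p (nbr H p)) (insert q (nbr H q))).card
      ≤ k ^ 2 + 1 := by
  have hsub : (univ.filter fun q => ¬ Disjoint (insert p (nbr H p)) (insert q (nbr H q)))
      ⊆ insert p ((nbr H p).biUnion fun q => insert q ((nbr H q).erase p)) := by
    intro q hq
    simp only [mem_filter, mem_univ, true_and, not_disjoint_iff, mem_insert, mem_nbr] at hq
    simp only [mem_insert, mem_biUnion, mem_nbr, mem_erase]
    by_cases hqp : q = p
    · exact Or.inl hqp
    right
    obtain ⟨a, rfl | ha, rfl | ha'⟩ := hq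
    · exact absurd rfl hqp
    · exact ⟨q, ha'.symm, Or.inl rfl⟩
    · exact ⟨a, ha, Or.inl rfl⟩
    · exact ⟨a, ha, Or.inr ⟨hqp, ha'.symm⟩⟩
  refine (card_le_card hsub).trans ((card_insert_le _ _).trans ?_)
  have h1 : ((nbr H p).biUnion fun q => insert q ((nbr H q).erase p)).card
      ≤ (nbr H p).card * k := by
    refine card_biUnion_le_card_mul _ _ _ fun q hq => (card_insert_le _ _).trans ?_
    rw [mem_nbr] at hq
    rw [card_erase_add_one (by simpa using hq.symm)]
    exact hH q
  have h2 := Nat.mul_le_mul_right k (hH p)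
  rw [sq]
  omega

/-- Greedy choice: each selected vertex blocks at most `k² + 1` others, and at most `m - 1` have
been selected before any choice. With `k = δ - 1` this produces the constant of the theorem. -/
lemma exists_disjoint_closed_nbr (hH : ∀ v, (nbr H v).card ≤ k) {m : ℕ} {D : Finset β}
    (hD : (m - 1) * (k ^ 2 + 1) < D.card) :
    ∃ P ⊆ D, P.card = m ∧
      (P : Set β).PairwiseDisjoint fun p => insert p (nbr H p) := by
  have key : ∀ i ≤ m, ∃ P ⊆ D, P.card = i ∧
      (P : Set β).PairwiseDisjoint fun p => insert p (nbr H p) := by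
    intro i
    induction i with
    | zero => exact fun _ => ⟨∅, by simp, by simp, by simp⟩
    | succ i ih =>
      intro hi
      obtain ⟨P, hPD, hPc, hPd⟩ := ih (by omega)
      let B := P.biUnion fun p =>
        univ.filter fun q => ¬ Disjoint (insert p (nbr H p)) (insert q (nbr H q))
      have hB : B.card ≤ P.card * (k ^ 2 + 1) :=
        card_biUnion_le_card_mul _ _ _ fun p _ => card_filter_not_disjoint_closed_nbr_le hH p
      have hlt : B.card < D.card := by
        refine hB.trans_lt (lt_of_le_of_lt ?_ hD)
        rw [hPc]
        exact Nat.mul_le_mul_right _ (by omega)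
      obtain ⟨q, hqD, hqB⟩ := exists_mem_notMem_of_card_lt_card hlt
      simp only [B, mem_biUnion, mem_filter, mem_univ, true_and, not_exists, not_and,
        not_not] at hqB
      have hqP : q ∉ P := by
        intro hqP
        have := hqB q hqP
        simp at this
      refine ⟨insert q P, insert_subset hqD hPD, by rw [card_insert_of_notMem hqP, hPc], ?_⟩
      rw [coe_insert]
      refine hPd.insert fun p hp _ => (hqB p hp).symm
  exact key m le_rfl

lemma copies_star_isContained {m δ : ℕ} {P : Finset β} (hPm : P.card = m)
    (hPd : ∀ p ∈ P, (nbr H p).card = δ - 1)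
    (hP : (P : Set β).PairwiseDisjoint fun p => insert p (nbr H p)) :
    (copies m (star δ)).IsContained H := by
  let e : Fin m ≃ P := (P.equivFinOfCardEq hPm).symm
  let g : ∀ i : Fin m, Fin (δ - 1) ≃ nbr H (e i) := fun i =>
    ((nbr H (e i)).equivFinOfCardEq (hPd _ (e i).2)).symm
  let φ : Fin m × (Fin 1 ⊕ Fin (δ - 1)) → β := fun q =>
    Sum.elim (fun _ => (e q.1 : β)) (fun j => (g q.1 j : β)) q.2
  have hmem : ∀ q, φ q ∈ insert (e q.1 : β) (nbr H (e q.1)) := by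
    rintro ⟨i, j | j⟩
    · simp [φ]
    · exact mem_insert_of_mem (g i j).2
  have hadj : ∀ i j, H.Adj (e i) (g i j) := fun i j => mem_nbr.1 (g i j).2
  refine isContained_of_injective φ ?_ ?_
  · intro q q' hqq
    have h1 : q.1 = q'.1 := by
      by_contra hne
      have hne' : (e q.1 : β) ≠ e q'.1 := fun h => hne (e.injective (Subtype.ext h))
      have := hP (e q.1).2 (e q'.1).2 hne'
      refine disjoint_left.1 this (hmem q) ?_
      rw [hqq]
      exact hmem q'
    obtain ⟨i, j | j⟩ := q <;> obtain ⟨i', j' | j'⟩ := q' <;> simp only at h1 <;> subst h1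
    · rw [Subsingleton.elim j j']
    · exact absurd hqq (hadj i j').ne
    · exact absurd hqq (hadj i j).ne'
    · rw [(g i).injective (Subtype.ext hqq)]
  · rintro ⟨i, j | j⟩ ⟨i', j' | j'⟩ ⟨h1, h2⟩ <;> simp only at h1 <;> subst h1
    · simp [star] at h2
    · exact hadj i j'
    · exact (hadj i j).symm
    · simp [star] at h2

end

lemma join_isContained_join {ι β γ : Type*} {G₁ G₂ : SimpleGraph ι} {H₁ : SimpleGraph β}
    {H₂ : SimpleGraph γ} (hG : G₁ ≤ G₂) (h : H₁.IsContained H₂) :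
    (join G₁ H₁).IsContained (join G₂ H₂) := by
  obtain ⟨φ⟩ := h
  refine isContained_of_injective (Sum.map id φ)
    (Function.Injective.sumMap Function.injective_id φ.injective) ?_
  rintro (a | a) (b | b) hab
  · exact join_adj_inl_inl.2 (hG (join_adj_inl_inl.1 hab))
  · exact join_adj_inl_inr
  · exact join_adj_inr_inl
  · exact join_adj_inr_inr.2 (φ.toHom.map_adj (join_adj_inr_inr.1 hab))

section
variable {l δ : ℕ} {ι β : Type*} [Fintype ι] [Fintype β] {G : SimpleGraph ι} {H : SimpleGraph β}

lemma nbr_join_inr [DecidableEq ι] [DecidableEq β] (v : β) :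
    nbr (join G H) (Sum.inr v) = univ.disjSum (nbr H v) := by
  ext (a | a)
  · simp [join_adj_inr_inl]
  · simp [join_adj_inr_inr]

lemma nbr_join_inl [DecidableEq ι] [DecidableEq β] (v : ι) :
    nbr (join G H) (Sum.inl v) = (nbr G v).disjSum univ := by
  ext (a | a)
  · simp [join_adj_inl_inl]
  · simp [join_adj_inl_inr]

lemma card_nbr_lt_of_free_join {V : Type*} [Fintype V] [DecidableEq V] {T : SimpleGraph V}
    {A : Finset V} (hA : IsHalf T A l δ) (hι : Fintype.card ι = l)
    (hβ : Fintype.card V + 1 ≤ Fintype.card β) (h : T.Free (join G H)) (v : β) :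
    (nbr H v).card < δ := by
  classical
  by_contra! hd
  refine h (isContained_of_hub hA (L := univ.map Function.Embedding.inl)
    (R := univ.map Function.Embedding.inr) (v := Sum.inr v) (by simpa using hι) (by simp)
    ?_ ?_ (by simpa using hβ))
  · simp [join_adj_inl_inr]
  · refine hd.trans ?_
    rw [← card_map (s := nbr H v) (Function.Embedding.inr (α := ι))]
    refine card_le_card fun u hu => ?_
    simp only [mem_map, mem_nbr] at hu
    obtain ⟨w, hw, rfl⟩ := hu
    simpa [join_adj_inr_inr] using hw

lemma card_filter_card_nbr_le_of_free_join {V : Type*} {T : SimpleGraph V} {m : ℕ}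
    (hemb : T.IsContained (join (⊥ : SimpleGraph (Fin l)) (copies m (star δ))))
    {G : SimpleGraph (Fin l)} (h : T.Free (join G H)) (hH : ∀ v, (nbr H v).card ≤ δ - 1) :
    (univ.filter fun v => (nbr H v).card = δ - 1).card ≤ (m - 1) * ((δ - 1) ^ 2 + 1) := by
  classical
  by_contra! hlt
  obtain ⟨P, hPD, hPm, hP⟩ := exists_disjoint_closed_nbr hH hlt
  refine h (hemb.trans (join_isContained_join bot_le (copies_star_isContained hPm ?_ hP)))
  intro p hp
  exact (mem_filter.1 (hPD hp)).2

end

/-! ### Nearly regular graphs of every degree -/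

section NearRegular
variable (N k h : ℕ)

/-- The residues `±1, …, ±k` modulo `N`. -/
noncomputable def shortJumps : Finset (ZMod N) :=
  (Icc 1 k).image (fun i : ℕ => (i : ZMod N)) ∪ (Icc 1 k).image (fun i : ℕ => -(i : ZMod N))

variable {N k h}

lemma natCast_eq_natCast_of_lt {i j : ℕ} (hi : i < N) (hj : j < N)
    (hij : (i : ZMod N) = (j : ZMod N)) : i = j := by
  rw [ZMod.natCast_eq_natCast_iff', Nat.mod_eq_of_lt hi, Nat.mod_eq_of_lt hj] at hij
  exact hij

lemma natCast_ne_neg_natCast {i j : ℕ} (hi : 0 < i) (hij : i + j < N) :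
    (i : ZMod N) ≠ -(j : ZMod N) := by
  intro h
  have h1 : ((i + j : ℕ) : ZMod N) = ((0 : ℕ) : ZMod N) := by
    push_cast
    rw [h]; ring
  have := natCast_eq_natCast_of_lt hij (by omega) h1
  omega

lemma card_shortJumps (hk : 2 * k < N) : (shortJumps N k).card = 2 * k := by
  rw [shortJumps, card_union_of_disjoint, card_image_of_injOn, card_image_of_injOn]
  · simp; ring
  · intro i hi j hj hij
    simp only [coe_Icc, Set.mem_Icc, neg_inj] at hi hj hij
    exact natCast_eq_natCast_of_lt (by omega) (by omega) hij
  · intro i hi j hj hij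
    simp only [coe_Icc, Set.mem_Icc] at hi hj hij
    exact natCast_eq_natCast_of_lt (by omega) (by omega) hij
  · rw [disjoint_left]
    intro a ha hb
    simp only [mem_image, mem_Icc] at ha hb
    obtain ⟨i, hi, rfl⟩ := ha
    obtain ⟨j, hj, hij⟩ := hb
    exact natCast_ne_neg_natCast (by omega) (by omega) hij.symm

lemma neg_mem_shortJumps {a : ZMod N} (ha : a ∈ shortJumps N k) : -a ∈ shortJumps N k := by
  simp only [shortJumps, mem_union, mem_image] at ha ⊢
  rcases ha with ⟨i, hi, rfl⟩ | ⟨i, hi, rfl⟩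
  · exact Or.inr ⟨i, hi, rfl⟩
  · exact Or.inl ⟨i, hi, by simp⟩

lemma zero_notMem_shortJumps (hk : 2 * k < N) : (0 : ZMod N) ∉ shortJumps N k := by
  simp only [shortJumps, mem_union, mem_image, mem_Icc]
  rintro (⟨i, hi, h⟩ | ⟨i, hi, h⟩)
  · have := natCast_eq_natCast_of_lt (N := N) (i := i) (j := 0) (by omega) (by omega)
      (by simpa using h)
    omega
  · have := natCast_eq_natCast_of_lt (N := N) (i := i) (j := 0) (by omega) (by omega)
      (by simpa using h)
    omega

lemma natCast_notMem_shortJumps (h1 : k < h) (h2 : h + k < N) :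
    (h : ZMod N) ∉ shortJumps N k := by
  simp only [shortJumps, mem_union, mem_image, mem_Icc]
  rintro (⟨i, hi, he⟩ | ⟨i, hi, he⟩)
  · have := natCast_eq_natCast_of_lt (N := N) (by omega) (by omega) he
    omega
  · exact natCast_ne_neg_natCast (by omega) (by omega) he.symm

variable (N k h)

/-- The circulant graph with jumps `±1, …, ±k`, together with the edges `{i, i + h}`, where
`0 ≤ i < N - h`, if `c` holds. -/
def nearRegular (c : Prop) : SimpleGraph (ZMod N) where
  Adj a b := a ≠ b ∧ (b - a ∈ shortJumps N k ∨ (c ∧ (b.val = a.val + h ∨ a.val = b.val + h)))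
  symm := ⟨fun a b hab => ⟨hab.1.symm, by
    rcases hab.2 with h1 | ⟨hc, h1⟩
    · left
      have := neg_mem_shortJumps h1
      rwa [neg_sub] at this
    · exact Or.inr ⟨hc, h1.symm⟩⟩⟩
  loopless := ⟨fun a hab => hab.1 rfl⟩

variable {N k h}
variable [NeZero N]

lemma nbr_nearRegular_false (hk : 2 * k < N) (a : ZMod N) :
    (nbr (nearRegular N k h False) a).card = 2 * k := by
  rw [← card_shortJumps hk, ← card_map (s := shortJumps N k) (addLeftEmbedding a)]
  congr 1
  ext b
  simp only [mem_nbr, nearRegular, false_and, or_false, mem_map, addLeftEmbedding_apply]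
  constructor
  · rintro ⟨-, hb⟩
    exact ⟨_, hb, by ring⟩
  · rintro ⟨s, hs, rfl⟩
    refine ⟨?_, by simpa using hs⟩
    intro h0
    have : s = 0 := by simpa using h0.symm
    rw [this] at hs
    exact zero_notMem_shortJumps hk hs

/-- The extra edges form a perfect matching if `N = 2h`. If `N = 2h + 1`, they cover every vertex
once except `h`, which is joined to both `0` and `2h`. They are defined through `val` because the
jumps `±h` modulo an odd `N` would add 2 to every degree. -/
lemma card_nbr_nearRegular_true (hkh : k < h) (hN : N = 2 * h ∨ N = 2 * h + 1) (a : ZMod N) :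
    2 * k + 1 ≤ (nbr (nearRegular N k h True) a).card ∧
      (nbr (nearRegular N k h True) a).card ≤ 2 * k + 2 ∧
      (a.val ≠ h → (nbr (nearRegular N k h True) a).card ≤ 2 * k + 1) := by
  let E : Finset (ZMod N) := univ.filter fun b => b.val = a.val + h ∨ a.val = b.val + h
  have hsub : ∀ b : ZMod N, b - a ∈ shortJumps N k → b ∉ E := by
    intro b hb hbE
    simp only [E, mem_filter, mem_univ, true_and] at hbE
    refine natCast_notMem_shortJumps (N := N) (k := k) (h := h) hkh (by omega) ?_
    rcases hbE with h1 | h1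
    · have : b - a = (h : ZMod N) := by
        rw [← ZMod.natCast_zmod_val b, h1]; simp
      rwa [this] at hb
    · have : b - a = -(h : ZMod N) := by
        rw [← ZMod.natCast_zmod_val a, h1]; simp
      rw [this] at hb
      simpa using neg_mem_shortJumps hb
  have hcard : (nbr (nearRegular N k h True) a).card = 2 * k + E.card := by
    rw [← card_shortJumps (N := N) (k := k) (by omega),
      ← card_map (s := shortJumps N k) (addLeftEmbedding a),
      ← card_union_of_disjoint]
    · congr 1
      ext b
      simp only [mem_nbr, nearRegular, true_and, mem_union, mem_map, addLeftEmbedding_apply, E,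
        mem_filter, mem_univ]
      constructor
      · rintro ⟨-, hb | hb⟩
        · exact Or.inl ⟨_, hb, by ring⟩
        · exact Or.inr hb
      · rintro (⟨s, hs, rfl⟩ | hb)
        · refine ⟨?_, Or.inl (by simpa using hs)⟩
          intro h0
          have : s = 0 := by simpa using h0.symm
          rw [this] at hs
          exact zero_notMem_shortJumps (by omega) hs
        · refine ⟨?_, Or.inr hb⟩
          rintro rfl
          omega
    · rw [disjoint_left]
      intro b hb
      simp only [mem_map, addLeftEmbedding_apply] at hb
      obtain ⟨s, hs, rfl⟩ := hb
      exact hsub _ (by simpa using hs)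
  have hval : ∀ i : ℕ, i < N → (i : ZMod N).val = i := fun i hi => ZMod.val_cast_of_lt hi
  have hlt := ZMod.val_lt a
  have hE1 : 1 ≤ E.card := by
    apply card_pos.2
    by_cases ha : a.val + h < N
    · exact ⟨((a.val + h : ℕ) : ZMod N), by simp only [E, mem_filter, hval _ ha]; simp⟩
    · refine ⟨((a.val - h : ℕ) : ZMod N), ?_⟩
      simp only [E, mem_filter, hval (a.val - h) (by omega), mem_univ, true_and]
      omega
  have hE2 : E ⊆ {((a.val + h : ℕ) : ZMod N), ((a.val - h : ℕ) : ZMod N)} := by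
    intro b hb
    simp only [E, mem_filter, mem_univ, true_and] at hb
    rw [mem_insert, mem_singleton]
    rcases hb with hb | hb
    · left
      rw [← hb, ZMod.natCast_zmod_val]
    · right
      rw [hb, Nat.add_sub_cancel, ZMod.natCast_zmod_val]
  have hE3 := (card_le_card hE2).trans card_le_two
  refine ⟨by omega, by omega, fun hne => ?_⟩
  have hE4 : E.card ≤ 1 := by
    rw [card_le_one]
    intro b hb c hc
    simp only [E, mem_filter, mem_univ, true_and] at hb hc
    have h1 := ZMod.val_lt b
    have h2 := ZMod.val_lt c
    apply ZMod.val_injective N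
    omega
  omega

/-- For large `N` there is a graph on `N` vertices whose degrees are all equal to `d`, except that
possibly one of them is `d + 1`. -/
lemma exists_nearRegular (d N : ℕ) (hN : 2 * d + 4 ≤ N) :
    ∃ (β : Type) (_ : Fintype β) (H : SimpleGraph β), Fintype.card β = N ∧
      (∀ v, d ≤ (nbr H v).card) ∧ (∀ v, (nbr H v).card ≤ d + 1) ∧
      ∀ v w, d + 1 ≤ (nbr H v).card → d + 1 ≤ (nbr H w).card → v = w := by
  have : NeZero N := ⟨by omega⟩
  obtain ⟨k, rfl | rfl⟩ := Nat.even_or_odd' d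
  · have h1 := nbr_nearRegular_false (N := N) (k := k) (h := 0) (by omega)
    refine ⟨ZMod N, inferInstance, nearRegular N k 0 False, ZMod.card N, ?_, ?_, ?_⟩
    · exact fun v => (h1 v).ge
    · exact fun v => (h1 v).le.trans (by omega)
    · intro v w hv
      rw [h1] at hv
      omega
  · have h1 := card_nbr_nearRegular_true (N := N) (k := k) (h := N / 2) (by omega) (by omega)
    refine ⟨ZMod N, inferInstance, nearRegular N k (N / 2) True, ZMod.card N, ?_, ?_, ?_⟩
    · exact fun v => (h1 v).1
    · exact fun v => (h1 v).2.1
    · intro v w hv hw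
      have key : ∀ v, 2 * k + 1 + 1 ≤ (nbr (nearRegular N k (N / 2) True) v).card →
          v.val = N / 2 := by
        intro v hv
        by_contra hne
        have := (h1 v).2.2 hne
        omega
      exact ZMod.val_injective N ((key v hv).trans (key w hw).symm)

end NearRegular

/-! ### The function `f` and the eigenvalue equation in a join -/

lemma sum_sum_nbr {α : Type*} [Fintype α] (G : SimpleGraph α) (g : α → ℝ) :
    ∑ u, ∑ v ∈ nbr G u, g v = ∑ v, (nbr G v).card * g v := by
  rw [sum_comm' (t' := univ) (s' := fun v => nbr G v)]
  · simp
  · simp [SimpleGraph.adj_comm]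

section
variable {l n : ℕ} {x : ℝ}

lemma f_eq : f l x n = ((l - 1 + x) + √((l - 1 - x) ^ 2 + 4 * (l * (n - l)))) / 2 := by
  rw [f]
  congr 2
  · ring
  · congr 1; ring

/-- This is the characteristic equation of the quotient matrix of `K_l` joined to an `x`-regular
graph on `n - l` vertices. By `max_le_f`, `f` is its larger root. All later estimates use these two
facts instead of the square root. -/
lemma f_mul (hn : l ≤ n) : (f l x n - x) * (f l x n - (l - 1)) = l * (n - l) := by
  have hn' : (l : ℝ) ≤ n := by exact_mod_cast hn
  have h : (0 : ℝ) ≤ (l - 1 - x) ^ 2 + 4 * (l * (n - l)) := by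
    have := mul_nonneg (Nat.cast_nonneg (α := ℝ) l) (sub_nonneg.2 hn')
    positivity
  rw [f_eq]
  have := Real.sq_sqrt h
  linear_combination this / 4

lemma max_le_f (hn : l ≤ n) : x ≤ f l x n ∧ l - 1 ≤ f l x n := by
  have hn' : (l : ℝ) ≤ n := by exact_mod_cast hn
  have h : |(l - 1 - x)| ≤ √((l - 1 - x) ^ 2 + 4 * (l * (n - l))) := by
    apply Real.abs_le_sqrt
    have := mul_nonneg (Nat.cast_nonneg (α := ℝ) l) (sub_nonneg.2 hn')
    linarith
  rw [f_eq]
  have h1 := le_abs_self ((l : ℝ) - 1 - x)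
  have h2 := neg_abs_le ((l : ℝ) - 1 - x)
  constructor <;> linarith

/-- The left side is the squared spectral radius of `K_{l,n-l}`; only this weaker bound is needed to
locate the hub. -/
lemma mul_le_f_sq (hn : l ≤ n) (hl : 1 ≤ l) (hx : 0 ≤ x) : l * (n - l) ≤ f l x n ^ 2 := by
  have hl' : (1 : ℝ) ≤ l := by exact_mod_cast hl
  obtain ⟨h1, h2⟩ := max_le_f (x := x) hn
  rw [← f_mul (x := x) hn]
  nlinarith

end

section
variable {l : ℕ} {β : Type*} [Fintype β] {H : SimpleGraph β}

lemma le_lam_join_top {d : ℕ} {q : ℝ} (hq : (q - d) * (q - (l - 1)) = l * Fintype.card β)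
    (hdq : d ≤ q) (hl : 1 ≤ l) (hβ : Nonempty β) (hH : ∀ v, d ≤ (nbr H v).card) :
    q ≤ lam (join (⊤ : SimpleGraph (Fin l)) H) := by
  classical
  have hl' : (1 : ℝ) ≤ l := by exact_mod_cast hl
  -- This vector is the eigenvector for `q` when `H` is `d`-regular; larger degrees in `H` only
  -- help.
  refine le_lam_of_supersolution (y := Sum.elim (fun _ => q - d) (fun _ => (l : ℝ))) ?_ ?_ ?_
  · intro h0
    have := congrFun h0 (Sum.inr hβ.some)
    simp only [Sum.elim_inr, Pi.zero_apply] at this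
    linarith
  · rintro (i | v)
    · simpa using hdq
    · simp
  · rintro (i | v)
    · have h1 : nbr (⊤ : SimpleGraph (Fin l)) i = univ.erase i := by
        ext; simp [eq_comm]
      rw [nbr_join_inl, sum_disjSum]
      simp only [Sum.elim_inl, Sum.elim_inr, sum_const, h1, card_erase_of_mem (mem_univ i),
        card_univ, Fintype.card_fin, nsmul_eq_mul]
      rw [Nat.cast_sub hl]
      push_cast
      linarith
    · rw [nbr_join_inr, sum_disjSum]
      simp only [Sum.elim_inl, Sum.elim_inr, sum_const, card_univ, Fintype.card_fin, nsmul_eq_mul]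
      have : (d : ℝ) ≤ (nbr H v).card := by exact_mod_cast hH v
      nlinarith

/-- Sum the eigenvalue equation over the right side: each entry is counted at most `d` times, with
one additional count, worth at most `b`, at each of the at most `C` vertices of degree `d + 1`. -/
lemma eigen_join_right {G : SimpleGraph (Fin l)} {y : Fin l ⊕ β → ℝ} {r b : ℝ} {d C : ℕ}
    (hy : ∀ u, ∑ v ∈ nbr (join G H) u, y v = r * y u) (hy0 : ∀ u, 0 ≤ y u)
    (hH : ∀ v, (nbr H v).card ≤ d + 1)
    (hC : (univ.filter fun v => (nbr H v).card = d + 1).card ≤ C)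
    (hb : ∀ v, y (Sum.inr v) ≤ b) (hb0 : 0 ≤ b) :
    (r - d) * ∑ v, y (Sum.inr v) ≤ Fintype.card β * ∑ i, y (Sum.inl i) + C * b := by
  classical
  have h1 : r * ∑ v, y (Sum.inr v)
      = Fintype.card β * ∑ i, y (Sum.inl i) + ∑ v, (nbr H v).card * y (Sum.inr v) := by
    rw [mul_sum, ← sum_sum_nbr]
    simp only [← hy, nbr_join_inr, sum_disjSum, sum_add_distrib, sum_const, card_univ,
      nsmul_eq_mul]
  have h2 : ∑ v, ((nbr H v).card : ℝ) * y (Sum.inr v)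
      ≤ ∑ v, (d * y (Sum.inr v) + if (nbr H v).card = d + 1 then b else 0) := by
    refine sum_le_sum fun v _ => ?_
    have h0 := hy0 (Sum.inr v)
    split_ifs with h
    · rw [h]
      push_cast
      linarith [hb v]
    · have : (nbr H v).card ≤ d := by have := hH v; omega
      have : ((nbr H v).card : ℝ) ≤ d := by exact_mod_cast this
      nlinarith
  rw [sum_add_distrib, ← mul_sum, ← sum_filter, sum_const, nsmul_eq_mul] at h2
  have h3 : ((univ.filter fun v => (nbr H v).card = d + 1).card : ℝ) * b ≤ C * b :=
    mul_le_mul_of_nonneg_right (by exact_mod_cast hC) hb0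
  linarith

lemma eigen_join_left {G : SimpleGraph (Fin l)} {y : Fin l ⊕ β → ℝ} {r : ℝ}
    (hy : ∀ u, ∑ v ∈ nbr (join G H) u, y v = r * y u) :
    r * ∑ i, y (Sum.inl i)
      = l * ∑ v, y (Sum.inr v) + ∑ i, (nbr G i).card * y (Sum.inl i) := by
  classical
  rw [mul_sum, ← sum_sum_nbr]
  simp only [← hy, nbr_join_inl, sum_disjSum, sum_add_distrib, sum_const, card_univ,
      nsmul_eq_mul, Fintype.card_fin]
  ring

lemma card_nbr_add_one_le {α : Type*} [Fintype α] (G : SimpleGraph α) (i : α) :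
    (nbr G i).card + 1 ≤ Fintype.card α := by
  classical
  rw [← card_insert_of_notMem (s := nbr G i) (a := i) (by simp)]
  exact card_le_univ _

/-- A missing edge lowers the degree-weighted sum on the left by at least `κ` times the total `s`
there. Eliminating the right sum gives `(r - d)(r - (l - 1) + κ) ≤ l|β| + lC`, which with `q ≤ r`
and the equation for `q` forces `κ(q - d) ≤ lC`. There is no need to know that adding the edge keeps
the graph `T`-free. -/
lemma eq_top_of_le_lam {G : SimpleGraph (Fin l)} {y : Fin l ⊕ β → ℝ} {r q κ : ℝ} {d C : ℕ}
    (hy : ∀ u, ∑ v ∈ nbr (join G H) u, y v = r * y u) (hy0 : ∀ u, 0 ≤ y u)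
    (hH : ∀ v, (nbr H v).card ≤ d + 1)
    (hC : (univ.filter fun v => (nbr H v).card = d + 1).card ≤ C)
    (hs : 0 < ∑ i, y (Sum.inl i)) (hb : ∀ v, y (Sum.inr v) ≤ ∑ i, y (Sum.inl i))
    (hκ : ∀ i, κ * ∑ i, y (Sum.inl i) ≤ y (Sum.inl i)) (hκ0 : 0 ≤ κ)
    (hq : (q - d) * (q - (l - 1)) = l * Fintype.card β) (hdq : d ≤ q) (hlq : l - 1 ≤ q)
    (hr : q ≤ r) (hlarge : l * C < κ * (q - d)) : G = ⊤ := by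
  classical
  by_contra hne
  obtain ⟨i, j, hij, hadj⟩ := SimpleGraph.ne_top_iff_exists_not_adj.1 hne
  have hright := eigen_join_right hy hy0 hH hC hb hs.le
  have hleft := eigen_join_left hy
  set s := ∑ i, y (Sum.inl i) with hsdef
  set S := ∑ v, y (Sum.inr v)
  have hdeg : ∑ i, ((nbr G i).card : ℝ) * y (Sum.inl i) ≤ (l - 1) * s - κ * s := by
    have h1 : ∑ a, ((nbr G a).card : ℝ) * y (Sum.inl a)
        ≤ ∑ a, ((l - 1) * y (Sum.inl a) - if a = i then y (Sum.inl i) else 0) := by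
      refine sum_le_sum fun a _ => ?_
      have h0 := hy0 (Sum.inl a)
      split_ifs with ha
      · subst ha
        have h2 : (nbr G a).card + 2 ≤ l := by
          have h3 : a ∉ insert j (nbr G a) := by simp [hij]
          have h4 : j ∉ nbr G a := by simpa using hadj
          have h5 := card_le_univ (insert a (insert j (nbr G a)))
          rw [card_insert_of_notMem h3, card_insert_of_notMem h4, Fintype.card_fin] at h5
          omega
        have h3 : ((nbr G a).card : ℝ) + 2 ≤ l := by exact_mod_cast h2
        nlinarith
      · have h2 := card_nbr_add_one_le G a
        rw [Fintype.card_fin] at h2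
        have h3 : ((nbr G a).card : ℝ) + 1 ≤ l := by exact_mod_cast h2
        nlinarith
    rw [sum_sub_distrib, ← mul_sum, sum_ite_eq' univ i, if_pos (mem_univ i)] at h1
    linarith [hκ i]
  have h1 : (r - (l - 1) + κ) * s ≤ l * S := by linarith
  have h2 : (r - d) * ((r - (l - 1) + κ) * s) ≤ (r - d) * (l * S) :=
    mul_le_mul_of_nonneg_left h1 (by linarith)
  have h3 : (l : ℝ) * ((r - d) * S) ≤ l * (Fintype.card β * s + C * s) :=
    mul_le_mul_of_nonneg_left hright (Nat.cast_nonneg _)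
  have h4 : (q - d) * (q - (l - 1) + κ) ≤ (r - d) * (r - (l - 1) + κ) :=
    mul_le_mul (by linarith) (by linarith) (by linarith) (by linarith)
  have h5 : (q - d) * (q - (l - 1) + κ) * s ≤ (l * Fintype.card β + l * C) * s := by
    refine (mul_le_mul_of_nonneg_right h4 hs.le).trans ?_
    linarith
  have h6 := le_of_mul_le_mul_right h5 hs
  linarith

/-- Eliminating the two sums gives `(r - q)(r + q - d - (l - 1)) ≤ lC / (r - (d + 1))`. The two
large factors make `r - q` of order `1/n`; bounding the right entries merely by `s` would lose one
of them. -/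
lemma lam_join_top_le {q e : ℝ} {d C : ℕ} (hl : 1 ≤ l)
    (hH : ∀ v, (nbr H v).card ≤ d + 1)
    (hC : (univ.filter fun v => (nbr H v).card = d + 1).card ≤ C)
    (hq : (q - d) * (q - (l - 1)) = l * Fintype.card β) (hdq : d + 1 < q) (hlq : l - 1 ≤ q)
    (he : 0 ≤ e) (hlarge : l * C ≤ e * ((2 * q - d - (l - 1)) * (q - (d + 1)))) :
    lam (join (⊤ : SimpleGraph (Fin l)) H) ≤ q + e := by
  classical
  by_contra! hlt
  have : Nonempty (Fin l ⊕ β) := ⟨Sum.inl ⟨0, hl⟩⟩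
  obtain ⟨y, hy0, hyne, hy⟩ := exists_perron (join (⊤ : SimpleGraph (Fin l)) H)
  set r := lam (join (⊤ : SimpleGraph (Fin l)) H)
  have hs0 : 0 ≤ ∑ i, y (Sum.inl i) := sum_nonneg fun i _ => hy0 _
  -- At a vertex `w` of `H` with maximal entry, the equation reads `r y_w ≤ s + (d + 1) y_w`.
  have hb : ∀ v, y (Sum.inr v) ≤ (∑ i, y (Sum.inl i)) / (r - (d + 1)) := by
    intro v
    obtain ⟨w, -, hw⟩ := univ.exists_max_image (fun v => y (Sum.inr v)) ⟨v, mem_univ v⟩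
    refine (hw v (mem_univ v)).trans ?_
    rw [le_div_iff₀ (by linarith)]
    have h1 := hy (Sum.inr w)
    rw [nbr_join_inr, sum_disjSum] at h1
    have h2 : ∑ u ∈ nbr H w, y (Sum.inr u) ≤ (nbr H w).card * y (Sum.inr w) := by
      rw [← nsmul_eq_mul]
      exact sum_le_card_nsmul _ _ _ fun u _ => hw u (mem_univ u)
    have h3 : ((nbr H w).card : ℝ) ≤ d + 1 := by exact_mod_cast hH w
    have h4 := mul_le_mul_of_nonneg_right h3 (hy0 (Sum.inr w))
    linarith
  have hs : 0 < ∑ i, y (Sum.inl i) := by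
    refine lt_of_le_of_ne hs0 fun h0 => hyne ?_
    rw [← h0] at hb
    ext u
    rcases u with i | v
    · exact (sum_eq_zero_iff_of_nonneg fun i _ => hy0 _).1 h0.symm i (mem_univ i)
    · exact le_antisymm (by simpa using hb v) (hy0 _)
  have hrd : 0 < r - (d + 1) := by linarith
  have hright := eigen_join_right hy hy0 hH hC hb (div_nonneg hs0 hrd.le)
  have hleft := eigen_join_left hy
  have hdeg : ∀ i : Fin l, ((nbr (⊤ : SimpleGraph (Fin l)) i).card : ℝ) = l - 1 := by
    intro i
    have h1 : nbr (⊤ : SimpleGraph (Fin l)) i = univ.erase i := by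
      ext; simp [eq_comm]
    rw [h1, card_erase_of_mem (mem_univ i), card_univ, Fintype.card_fin, Nat.cast_sub hl]
    simp
  simp only [hdeg] at hleft
  rw [← mul_sum] at hleft
  set s := ∑ i, y (Sum.inl i) with hsdef
  set S := ∑ v, y (Sum.inr v)
  have h1 : (r - d) * (r - (l - 1)) * s = l * ((r - d) * S) := by linear_combination (r - d) * hleft
  have h2 : (r - d) * (r - (l - 1)) * s ≤ l * (Fintype.card β * s + C * (s / (r - (d + 1)))) := by
    rw [h1]
    exact mul_le_mul_of_nonneg_left hright (Nat.cast_nonneg _)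
  have h3 : ((r - d) * (r - (l - 1)) - l * Fintype.card β) * (r - (d + 1)) * s ≤ l * C * s := by
    have h4 : s / (r - (d + 1)) * (r - (d + 1)) = s := div_mul_cancel₀ _ hrd.ne'
    have h5 := mul_le_mul_of_nonneg_right h2 hrd.le
    have h6 : l * (Fintype.card β * s + C * (s / (r - (d + 1)))) * (r - (d + 1))
      = l * Fintype.card β * s * (r - (d + 1)) + l * C * s := by
      linear_combination (l * C : ℝ) * h4
    linarith
  have h4 := le_of_mul_le_mul_right h3 hs
  rw [← hq] at h4
  have h5 : (r - d) * (r - (l - 1)) - (q - d) * (q - (l - 1))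
      = (r - q) * (r + q - d - (l - 1)) := by ring
  rw [h5] at h4
  have hl' : (1 : ℝ) ≤ l := by exact_mod_cast hl
  have h6 : e * ((2 * q - d - (l - 1)) * (q - (d + 1)))
      < (r - q) * (r + q - d - (l - 1)) * (r - (d + 1)) := by
    rw [mul_assoc]
    refine mul_lt_mul'' (by linarith) ?_ he ?_
    · refine mul_lt_mul'' (by linarith) (by linarith) (by linarith) (by linarith)
    · exact mul_nonneg (by linarith) (by linarith)
  linarith

end

/-! ### Perron entries near a hub, and reattachment -/

lemma card_mul_sum_le {α : Type*} [Fintype α] {G : SimpleGraph α} {L R : Finset α} {x : α → ℝ}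
    {r : ℝ} (hx : ∀ u, ∑ v ∈ nbr G u, x v = r * x u)
    (hx0 : ∀ u, 0 ≤ x u) (hr : 0 ≤ r) (hLR : ∀ w ∈ L, ∀ v ∈ R, G.Adj w v) {w : α} (hw : w ∈ L) :
    R.card * ∑ w ∈ L, x w ≤ r ^ 2 * x w := by
  -- Two steps of the eigenvalue equation, from `w` to `R` and from there back to all of `L`,
  -- balance the entries on `L`.
  have h1 : ∀ v ∈ R, ∑ w ∈ L, x w ≤ r * x v := by
    intro v hv
    rw [← hx]
    exact sum_le_sum_of_subset_of_nonneg (fun u hu => mem_nbr.2 (hLR u hu v hv).symm)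
      fun i _ _ => hx0 i
  have h2 : ∑ v ∈ R, x v ≤ r * x w := by
    rw [← hx]
    exact sum_le_sum_of_subset_of_nonneg (fun u hu => mem_nbr.2 (hLR w hw u hu))
      fun i _ _ => hx0 i
  have h3 := sum_le_sum h1
  rw [sum_const, nsmul_eq_mul, ← mul_sum] at h3
  have h4 := mul_le_mul_of_nonneg_left h2 hr
  calc _ ≤ _ := h3
    _ ≤ _ := h4
    _ = _ := by ring

section
variable {α : Type*} [DecidableEq α] {G : SimpleGraph α} {L R E : Finset α}

/-- The graph obtained from `G` by making `L` the neighbourhood of every vertex of `E`. -/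
def reattach (G : SimpleGraph α) (L E : Finset α) (h : Disjoint E L) : SimpleGraph α where
  Adj a b := (a ∉ E ∧ b ∉ E ∧ G.Adj a b) ∨ (a ∈ E ∧ b ∈ L) ∨ (a ∈ L ∧ b ∈ E)
  symm := ⟨fun a b hab => by
    rcases hab with ⟨h1, h2, h3⟩ | ⟨h1, h2⟩ | ⟨h1, h2⟩
    · exact Or.inl ⟨h2, h1, h3.symm⟩
    · exact Or.inr (Or.inr ⟨h2, h1⟩)
    · exact Or.inr (Or.inl ⟨h2, h1⟩)⟩
  loopless := ⟨fun a hab => by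
    rcases hab with ⟨h1, h2, h3⟩ | ⟨h1, h2⟩ | ⟨h1, h2⟩
    · exact G.irrefl h3
    · exact disjoint_left.1 h h1 h2
    · exact disjoint_left.1 h h2 h1⟩

/-- In the new graph the vertices of `E` see only `L`, so in a copy of `T` they can be replaced by
unused vertices of `R`, which see all of `L` in `G`. The size of `R` leaves enough of them outside
the copy. -/
lemma free_reattach {V : Type*} [Fintype V] {T : SimpleGraph V} (hT : T.Free G)
    (hEL : Disjoint E L) (hLR : ∀ w ∈ L, ∀ v ∈ R, G.Adj w v)
    (hR : Fintype.card V + Fintype.card V ≤ R.card) : T.Free (reattach G L E hEL) := by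
  classical
  rintro ⟨φ⟩
  apply hT
  rcases isEmpty_or_nonempty V with hV | ⟨⟨v₀⟩⟩
  · exact isContained_of_injective (fun v => hV.elim v) (fun v => hV.elim v) fun v => hV.elim v
  have : Nonempty α := ⟨φ v₀⟩
  obtain ⟨g, hg, hgi⟩ := exists_injOn_of_card_le (s := (univ : Finset V))
    (t := R \ univ.image φ) (by
      have h1 := le_card_sdiff (univ.image φ) R
      have h2 : (univ.image φ).card ≤ Fintype.card V := card_image_le
      rw [card_univ]
      omega)
  have hgR : ∀ v, g v ∈ R := fun v => (mem_sdiff.1 (hg v (mem_univ v))).1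
  have hgφ : ∀ v u, φ u ≠ g v := fun v u h =>
    (mem_sdiff.1 (hg v (mem_univ v))).2 (mem_image.2 ⟨u, mem_univ u, h⟩)
  refine isContained_of_injective (fun v => if φ v ∈ E then g v else φ v) ?_ ?_
  · intro u v huv
    simp only at huv
    split_ifs at huv
    · exact hgi (mem_coe.2 (mem_univ u)) (mem_coe.2 (mem_univ v)) huv
    · exact absurd huv.symm (hgφ _ _)
    · exact absurd huv (hgφ _ _)
    · exact φ.injective huv
  · intro u v huv
    have hadj : (reattach G L E hEL).Adj (φ u) (φ v) := φ.toHom.map_adj huv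
    rcases hadj with ⟨h1, h2, h3⟩ | ⟨h1, h2⟩ | ⟨h1, h2⟩
    · simpa [h1, h2] using h3
    · have h3 : φ v ∉ E := fun h => disjoint_left.1 hEL h h2
      simpa [h1, h3] using (hLR _ h2 _ (hgR u)).symm
    · have h3 : φ u ∉ E := fun h => disjoint_left.1 hEL h h1
      simpa [h2, h3] using hLR _ h1 _ (hgR v)

end

section
variable {α : Type*} [Fintype α] [DecidableEq α] {G : SimpleGraph α}

/-- The adjacency form of a graph with out-degrees at most `d` and degrees at most `Δ` on `S` is
bounded by `t * d + Δ / t` for each `t > 0`. -/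
lemma sum_sum_nbr_inter_le {S : Finset α} {out : α → Finset α} {d : ℕ} {Δ t : ℝ} {y : α → ℝ}
    (hout : ∀ u, (out u).card ≤ d) (hsub : ∀ u, out u ⊆ nbr G u)
    (hcov : ∀ u v, G.Adj u v → v ∈ out u ∨ u ∈ out v) (hΔ : ∀ v ∈ S, (nbr G v).card ≤ Δ)
    (ht : 0 < t) (hy : ∀ u, 0 ≤ y u) :
    ∑ u ∈ S, ∑ v ∈ nbr G u ∩ S, y u * y v ≤ (t * d + Δ / t) * ∑ u ∈ S, y u ^ 2 := by
  have hyy : ∀ u v, 0 ≤ y u * y v := fun u v => mul_nonneg (hy u) (hy v)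
  have hin : ∀ v, S.filter (fun u => v ∈ out u) ⊆ nbr G v := by
    intro v u hu
    simpa [SimpleGraph.adj_comm] using hsub u (mem_filter.1 hu).2
  have h1 : ∀ u ∈ S, ∑ v ∈ nbr G u ∩ S, y u * y v
      ≤ ∑ v ∈ S, ((if v ∈ out u then y u * y v else 0) + if u ∈ out v then y v * y u else 0) := by
    intro u hu
    rw [inter_comm, ← sum_ite_mem]
    refine sum_le_sum fun v hv => ?_
    have h0 := hyy u v
    have h0' := hyy v u
    by_cases h : G.Adj u v
    · rw [if_pos (by simpa using h)]
      rcases hcov u v h with h' | h'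
      · rw [if_pos h']
        split_ifs <;> linarith
      · rw [if_pos h']
        split_ifs <;> nlinarith
    · rw [if_neg (by simpa using h)]
      split_ifs <;> linarith
  have h2 : ∑ u ∈ S, ∑ v ∈ S, ((if v ∈ out u then y u * y v else 0)
      + if u ∈ out v then y v * y u else 0)
      = ∑ u ∈ S, ∑ v ∈ S, if v ∈ out u then 2 * (y u * y v) else 0 := by
    simp only [sum_add_distrib]
    rw [sum_comm (f := fun u v => if u ∈ out v then y v * y u else 0), ← sum_add_distrib]
    refine sum_congr rfl fun u _ => ?_
    rw [← sum_add_distrib]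
    refine sum_congr rfl fun v _ => ?_
    split_ifs <;> ring
  -- Weighted AM–GM on each arc: the tail, with few outgoing arcs, gets weight `t`, and the head,
  -- with possibly many incoming ones, gets `1 / t`.
  have h3 : ∑ u ∈ S, ∑ v ∈ S, (if v ∈ out u then 2 * (y u * y v) else 0)
      ≤ ∑ u ∈ S, ∑ v ∈ S, ((if v ∈ out u then t * y u ^ 2 else 0)
        + if v ∈ out u then y v ^ 2 / t else 0) := by
    refine sum_le_sum fun u _ => sum_le_sum fun v _ => ?_
    split_ifs
    · have : t * y u ^ 2 + y v ^ 2 / t - 2 * (y u * y v) = (t * y u - y v) ^ 2 / t := by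
        field_simp
        ring
      have h4 : 0 ≤ (t * y u - y v) ^ 2 / t := by positivity
      linarith
    · simp
  refine (sum_le_sum h1).trans (h2.le.trans (h3.trans ?_))
  simp only [sum_add_distrib]
  rw [add_mul]
  refine add_le_add ?_ ?_
  · rw [mul_sum]
    refine sum_le_sum fun u _ => ?_
    rw [← sum_filter, sum_const, nsmul_eq_mul]
    have h4 : ((S.filter fun v => v ∈ out u).card : ℝ) ≤ d := by
      have : (S.filter fun v => v ∈ out u) ⊆ out u := fun v hv => (mem_filter.1 hv).2
      exact_mod_cast (card_le_card this).trans (hout u)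
    have := mul_le_mul_of_nonneg_right h4 (show 0 ≤ t * y u ^ 2 by positivity)
    linarith
  · rw [sum_comm, mul_sum]
    refine sum_le_sum fun v hv => ?_
    rw [← sum_filter, sum_const, nsmul_eq_mul]
    have h4 : ((S.filter fun u => v ∈ out u).card : ℝ) ≤ Δ := by
      refine le_trans ?_ (hΔ v hv)
      exact_mod_cast card_le_card (hin v)
    have := mul_le_mul_of_nonneg_right h4 (show 0 ≤ y v ^ 2 / t by positivity)
    calc _ ≤ _ := this
      _ = _ := by ring

/-- The choice `t = √n` with the trivial degree bound `n`. -/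
lemma lam_le_of_orientation [Nonempty α] {out : α → Finset α} {d : ℕ}
    (hout : ∀ u, (out u).card ≤ d) (hsub : ∀ u, out u ⊆ nbr G u)
    (hcov : ∀ u v, G.Adj u v → v ∈ out u ∨ u ∈ out v) :
    lam G ≤ (d + 1) * √(Fintype.card α) := by
  obtain ⟨y, hy0, hyne, hy⟩ := exists_perron G
  have hn : 0 < √(Fintype.card α : ℝ) := by
    apply Real.sqrt_pos.2
    exact_mod_cast Fintype.card_pos
  have h1 := sum_sum_nbr_inter_le (S := univ) (Δ := Fintype.card α) hout hsub hcov
    (fun v _ => by exact_mod_cast card_le_univ (nbr G v)) hn hy0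
  simp only [inter_univ] at h1
  rw [Real.div_sqrt] at h1
  have h2 := quad_eq_of_eigen hy
  rw [quad] at h2
  rw [h2] at h1
  have h3 : 0 < ∑ u, y u ^ 2 := by
    obtain ⟨u, hu⟩ := Function.ne_iff.1 hyne
    exact sum_pos' (fun _ _ => sq_nonneg _) ⟨u, mem_univ _, by simpa using sq_pos_of_ne_zero hu⟩
  have := le_of_mul_le_mul_right h1 h3
  linarith

variable {L R E : Finset α} {x : α → ℝ} {r : ℝ}

lemma eigen_le_add (hx : ∀ u, ∑ v ∈ nbr G u, x v = r * x u) (hx0 : ∀ u, 0 ≤ x u) (L : Finset α)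
    (v : α) : r * x v ≤ ∑ w ∈ L, x w + ∑ u ∈ nbr G v \ L, x u := by
  rw [← hx, ← sum_inter_add_sum_sdiff (nbr G v) L]
  gcongr
  · exact fun i _ _ => hx0 i
  · exact inter_subset_right

/-- The eigenvalue equation is used twice at a maximal entry outside `L`. One step would compare
`r`, of order `√n`, with `m + |E|`, where `|E|` may be linear in `n`. In two steps `r²` competes
with the number of 2-walks avoiding `L`, which is only a small multiple of `n`. -/
lemma sq_mul_entry_le {m : ℕ} {v : α} (hx : ∀ u, ∑ v ∈ nbr G u, x v = r * x u)
    (hx0 : ∀ u, 0 ≤ x u) (hr : 0 ≤ r) (hcov : ∀ v, v ∈ L ∨ v ∈ R ∨ v ∈ E)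
    (hEL : Disjoint E L) (hRL : Disjoint R L)
    (hR : ∀ v ∉ L, (nbr G v ∩ R).card ≤ m)
    (hE : ∑ u ∈ E, (nbr G u ∩ E).card ≤ 2 * m * E.card)
    (hv : v ∉ L) (hmax : ∀ u ∉ L, x u ≤ x v) :
    r ^ 2 * x v ≤ (r + m + E.card) * ∑ w ∈ L, x w + (m ^ 2 + 4 * m * E.card) * x v := by
  set s := ∑ w ∈ L, x w
  have hs : 0 ≤ s := sum_nonneg fun i _ => hx0 i
  have hsub : ∀ u, nbr G u \ L ⊆ (nbr G u ∩ R) ∪ (nbr G u ∩ E) := by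
    intro u w hw
    rw [mem_sdiff] at hw
    rw [mem_union, mem_inter, mem_inter]
    rcases hcov w with h | h | h
    · exact absurd h hw.2
    · exact Or.inl ⟨hw.1, h⟩
    · exact Or.inr ⟨hw.1, h⟩
  have hdeg : ∀ u, (nbr G u \ L).card ≤ (nbr G u ∩ R).card + (nbr G u ∩ E).card := fun u =>
    (card_le_card (hsub u)).trans (card_union_le _ _)
  have hdeg' : ∀ u ∉ L, (nbr G u \ L).card ≤ m + E.card := fun u hu =>
    (hdeg u).trans (add_le_add (hR u hu) (card_le_card inter_subset_right))
  -- Walks through `R` number at most `m(m + |E|)`; those through `E` at most `m|E| + 2m|E|`, by the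
  -- edge count inside `E`.
  have hwalk : ∑ u ∈ nbr G v \ L, (nbr G u \ L).card ≤ m ^ 2 + 4 * m * E.card := by
    have h1 : ∑ u ∈ nbr G v \ L, (nbr G u \ L).card
        ≤ ∑ u ∈ (nbr G v ∩ R), (nbr G u \ L).card + ∑ u ∈ E, (nbr G u \ L).card := by
      refine (sum_le_sum_of_subset ((hsub v).trans
        (union_subset_union_right inter_subset_right))).trans ?_
      rw [← sum_union_inter]
      exact Nat.le_add_right _ _
    have h2 : ∑ u ∈ (nbr G v ∩ R), (nbr G u \ L).card ≤ m * (m + E.card) := by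
      have h3 : ∑ u ∈ (nbr G v ∩ R), (nbr G u \ L).card ≤ (nbr G v ∩ R).card • (m + E.card) := by
        refine sum_le_card_nsmul _ _ _ fun u hu => hdeg' u ?_
        exact disjoint_left.1 hRL (mem_inter.1 hu).2
      exact h3.trans (Nat.mul_le_mul_right _ (hR v hv))
    have h4 : ∑ u ∈ E, (nbr G u \ L).card ≤ m * E.card + 2 * m * E.card := by
      refine (sum_le_sum fun u _ => hdeg u).trans ?_
      rw [sum_add_distrib]
      refine add_le_add ?_ hE
      rw [mul_comm]
      exact sum_le_card_nsmul _ _ _ fun u hu => hR u (disjoint_left.1 hEL hu)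
    nlinarith
  have h1 := eigen_le_add hx hx0 L v
  have h2 : ∀ u ∈ nbr G v \ L, r * x u ≤ s + (nbr G u \ L).card * x v := by
    intro u _
    refine (eigen_le_add hx hx0 L u).trans ?_
    gcongr
    rw [← nsmul_eq_mul]
    exact sum_le_card_nsmul _ _ _ fun w hw => hmax w (mem_sdiff.1 hw).2
  have h3 := sum_le_sum h2
  rw [← mul_sum, sum_add_distrib, ← sum_mul, sum_const, nsmul_eq_mul] at h3
  have h4 : ((nbr G v \ L).card : ℝ) * s ≤ (m + E.card) * s := by
    refine mul_le_mul_of_nonneg_right ?_ hs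
    exact_mod_cast hdeg' v hv
  have h5 : (∑ u ∈ nbr G v \ L, ((nbr G u \ L).card : ℝ)) * x v
      ≤ (m ^ 2 + 4 * m * E.card) * x v := by
    refine mul_le_mul_of_nonneg_right ?_ (hx0 v)
    exact_mod_cast hwalk
  have h6 := mul_le_mul_of_nonneg_left h1 hr
  nlinarith

lemma quad_eq_sum_ite (G : SimpleGraph α) (y : α → ℝ) :
    quad G y = ∑ u, ∑ v, if v ∈ nbr G u then y u * y v else 0 := by
  rw [quad]
  refine sum_congr rfl fun u _ => ?_
  rw [sum_ite_mem, univ_inter]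

/-- Entrywise comparison of two adjacency forms: `a` and `g` stand for adjacency before and after
reattaching, `p` and `q` for arcs that may be lost, `e₁` and `e₂` for one guaranteed new edge at
each end. -/
lemma ite_le_ite_add {a g p q e₁ e₂ : Prop} [Decidable a] [Decidable g] [Decidable p]
    [Decidable q] [Decidable e₁] [Decidable e₂] {z : ℝ} (hz : 0 ≤ z)
    (h₁ : e₁ → g ∧ ¬ a ∧ ¬ e₂) (h₂ : e₂ → g ∧ ¬ a) (h : a → g ∨ p ∨ q) :
    (if a then z else 0) ≤ (if g then z else 0) + (((if p then z else 0) - if e₁ then z else 0)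
      + ((if q then z else 0) - if e₂ then z else 0)) := by
  by_cases h₁' : e₁
  · obtain ⟨hg, ha, h₂'⟩ := h₁ h₁'
    simp only [hg, ha, h₁', h₂', if_true, if_false]
    split_ifs <;> linarith
  by_cases h₂' : e₂
  · obtain ⟨hg, ha⟩ := h₂ h₂'
    simp only [hg, ha, h₁', h₂', if_true, if_false]
    split_ifs <;> linarith
  · simp only [h₁', h₂', if_false]
    split_ifs <;> first | linarith | tauto

/-- If reattaching the vertices of `E` to `L` does not increase the spectral radius, and the
entries of the Perron vector outside `L` are small, then `E` is empty. -/
lemma eq_empty_of_lam_reattach_le {out : α → Finset α} {D : ℕ} {b : ℝ}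
    (hx : ∀ u, ∑ v ∈ nbr G u, x v = lam G * x u) (hx0 : ∀ u, 0 ≤ x u) (hEL : Disjoint E L)
    (hlam : lam (reattach G L E hEL) ≤ lam G)
    (hL : ∀ u ∈ E, ∃ w ∈ L, ¬ G.Adj u w)
    (hout : ∀ u ∈ E, (out u).card ≤ D) (houtL : ∀ u ∈ E, Disjoint (out u) L)
    (hcov : ∀ u ∈ E, ∀ v ∉ L, G.Adj u v → v ∈ out u ∨ v ∈ E ∧ u ∈ out v)
    (hb : ∀ v ∉ L, x v ≤ b) (hb0 : 0 ≤ b)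
    (hDb : ∀ w ∈ L, D * b < x w) : E = ∅ := by
  have hL' : ∀ u, ∃ w, u ∈ E → w ∈ L ∧ ¬ G.Adj u w := by
    intro u
    by_cases hu : u ∈ E
    · obtain ⟨w, hw⟩ := hL u hu
      exact ⟨w, fun _ => hw⟩
    · exact ⟨u, fun h => absurd h hu⟩
  choose w hw using hL'
  classical
  set G' := reattach G L E hEL with hG'
  -- `P u` bounds what `u ∈ E` loses, its arcs in `out u`, minus what it gains from one new edge to
  -- a non-neighbour `w u ∈ L`. Other gained edges are ignored.
  let P : α → α → ℝ := fun u v => (if u ∈ E ∧ v ∈ out u then x u * x v else 0)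
    - if u ∈ E ∧ v = w u then x u * x v else 0
  have hP : ∀ u, ∑ v, P u v = if u ∈ E then x u * (∑ v ∈ out u, x v - x (w u)) else 0 := by
    intro u
    by_cases hu : u ∈ E
    · simp only [P, hu, true_and, if_true, sum_sub_distrib]
      rw [sum_ite_mem, univ_inter, sum_ite_eq' univ (w u), if_pos (mem_univ _), ← mul_sum]
      ring
    · simp [P, hu]
  have hneg : ∀ u ∈ E, ∑ v ∈ out u, x v - x (w u) < 0 := by
    intro u hu
    have h1 : ∑ v ∈ out u, x v ≤ (out u).card * b := by
      rw [← nsmul_eq_mul]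
      exact sum_le_card_nsmul _ _ _ fun v hv => hb v (disjoint_left.1 (houtL u hu) hv)
    have h2 : ((out u).card : ℝ) * b ≤ D * b :=
      mul_le_mul_of_nonneg_right (by exact_mod_cast hout u hu) hb0
    linarith [hDb _ (hw u hu).1]
  have hPle : ∀ u, ∑ v, P u v ≤ 0 := by
    intro u
    rw [hP]
    split_ifs with hu
    · exact mul_nonpos_of_nonneg_of_nonpos (hx0 u) (hneg u hu).le
    · exact le_rfl
  have hquad : quad G x ≤ quad G' x + 2 * ∑ u, ∑ v, P u v := by
    have h1 : quad G x ≤ ∑ u, ∑ v, ((if v ∈ nbr G' u then x u * x v else 0) + (P u v + P v u)) := by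
      rw [quad_eq_sum_ite]
      refine sum_le_sum fun u _ => sum_le_sum fun v _ => ?_
      have h0 : 0 ≤ x u * x v := mul_nonneg (hx0 u) (hx0 v)
      have hcomm : x v * x u = x u * x v := mul_comm _ _
      have hn : v ∈ nbr G' u ↔
        (u ∉ E ∧ v ∉ E ∧ G.Adj u v) ∨ (u ∈ E ∧ v ∈ L) ∨ (u ∈ L ∧ v ∈ E) := mem_nbr
      have hdis : ∀ a, a ∈ E → a ∉ L := fun a h => disjoint_left.1 hEL h
      simp only [P, hcomm]
      refine ite_le_ite_add h0 ?_ ?_ ?_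
      · rintro ⟨hu, rfl⟩
        refine ⟨hn.2 (Or.inr (Or.inl ⟨hu, (hw u hu).1⟩)), ?_, fun h => hdis _ h.1 (hw u hu).1⟩
        rw [mem_nbr]
        exact (hw u hu).2
      · rintro ⟨hv, rfl⟩
        refine ⟨hn.2 (Or.inr (Or.inr ⟨(hw v hv).1, hv⟩)), ?_⟩
        rw [mem_nbr]
        exact fun h => (hw v hv).2 h.symm
      · intro ha
        rw [mem_nbr] at ha
        by_cases hu : u ∈ E
        · by_cases hvL : v ∈ L
          · exact Or.inl (hn.2 (Or.inr (Or.inl ⟨hu, hvL⟩)))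
          · rcases hcov u hu v hvL ha with h | h
            · exact Or.inr (Or.inl ⟨hu, h⟩)
            · exact Or.inr (Or.inr h)
        by_cases hv : v ∈ E
        · by_cases huL : u ∈ L
          · exact Or.inl (hn.2 (Or.inr (Or.inr ⟨huL, hv⟩)))
          · rcases hcov v hv u huL ha.symm with h | h
            · exact Or.inr (Or.inr ⟨hv, h⟩)
            · exact Or.inr (Or.inl h)
        · exact Or.inl (hn.2 (Or.inl ⟨hu, hv, ha⟩))
    refine h1.trans_eq ?_
    simp only [sum_add_distrib]
    rw [sum_comm (f := fun u v => P v u), quad_eq_sum_ite]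
    ring
  have hPsum : ∑ u, ∑ v, P u v ≤ 0 := sum_nonpos fun u _ => hPle u
  have hsq : 0 ≤ ∑ u, x u ^ 2 := sum_nonneg fun u _ => sq_nonneg _
  have hG := quad_eq_of_eigen hx
  have h2 := mul_le_mul_of_nonneg_right hlam hsq
  by_contra hne
  obtain ⟨u, hu⟩ := nonempty_iff_ne_empty.2 hne
  -- The form does not decrease and `λ` does not increase, so `x` is an eigenvector of `G'` too.
  -- There the neighbourhood of `u` is `L`, hence `x u > 0`, and the comparison becomes strict.
  have h3 := eigen_of_le_quad G' x (by linarith) u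
  have h4 : nbr G' u = L := by
    ext v
    rw [mem_nbr]
    have := disjoint_left.1 hEL hu
    simp [hG', reattach, hu, this]
  rw [h4] at h3
  have h5 : 0 < ∑ v ∈ L, x v := by
    refine sum_pos (fun v hv => lt_of_le_of_lt (by positivity) (hDb v hv)) ?_
    exact ⟨w u, (hw u hu).1⟩
  have h6 : 0 < x u := by
    refine lt_of_le_of_ne (hx0 u) fun h => ?_
    rw [← h, mul_zero] at h3
    linarith
  have h7 : ∑ u, ∑ v, P u v < 0 := by
    refine sum_neg' (fun u _ => hPle u) ⟨u, mem_univ u, ?_⟩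
    rw [hP, if_pos hu]
    exact mul_neg_of_pos_of_neg h6 (hneg u hu)
  have h8 := quad_le_lam G' x
  linarith

end

/-! ### Finding the hub -/

/-- The set of common neighbours of the vertices of `L`. -/
noncomputable def common {α : Type*} [Fintype α] (G : SimpleGraph α) (L : Finset α) :
    Finset α := by
  classical exact univ.filter fun v => ∀ w ∈ L, G.Adj w v

@[simp] lemma mem_common {α : Type*} [Fintype α] {G : SimpleGraph α} {L : Finset α} {v : α} :
    v ∈ common G L ↔ ∀ w ∈ L, G.Adj w v := by
  simp [common]

/-- By Cauchy–Schwarz a set of at most `l` entries has squared sum at most `lZ`. Near-equality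
requires exactly `l` entries that carry almost all of `Z`; an entry outside such a set is too small
to belong to another one. -/
lemma eq_of_sq_sum_gt {α : Type*} [DecidableEq α] {l : ℕ} {W N N' : Finset α} {x : α → ℝ}
    (hl : 1 ≤ l) (hN : N ⊆ W) (hN' : N' ⊆ W) (hNl : N.card ≤ l) (hNl' : N'.card ≤ l)
    (h : (l - 1 / 10) * ∑ w ∈ W, x w ^ 2 < (∑ w ∈ N, x w) ^ 2)
    (h' : (l - 1 / 10) * ∑ w ∈ W, x w ^ 2 < (∑ w ∈ N', x w) ^ 2) :
    N = N' ∧ N.card = l := by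
  set Z := ∑ w ∈ W, x w ^ 2
  have hZ : 0 ≤ Z := sum_nonneg fun _ _ => sq_nonneg _
  have hl' : (1 : ℝ) ≤ l := by exact_mod_cast hl
  have hsub : ∀ M : Finset α, M ⊆ W → ∑ w ∈ M, x w ^ 2 ≤ Z := fun M hM =>
    sum_le_sum_of_subset_of_nonneg hM fun _ _ _ => sq_nonneg _
  have hcard : ∀ M : Finset α, M ⊆ W → M.card ≤ l →
      (l - 1 / 10) * Z < (∑ w ∈ M, x w) ^ 2 → M.card = l := by
    intro M hM hMl hlt
    by_contra hne
    have h1 : M.card + 1 ≤ l := by omega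
    have h2 : (M.card : ℝ) + 1 ≤ l := by exact_mod_cast h1
    have h3 : (∑ w ∈ M, x w) ^ 2 ≤ M.card * ∑ w ∈ M, x w ^ 2 := sq_sum_le_card_mul_sum_sq
    have h4 := mul_le_mul_of_nonneg_left (hsub M hM) (Nat.cast_nonneg (α := ℝ) M.card)
    nlinarith
  have hc := hcard N hN hNl h
  have hc' := hcard N' hN' hNl' h'
  refine ⟨?_, hc⟩
  by_contra hne
  obtain ⟨w, hw', hw⟩ : ∃ w ∈ N', w ∉ N := by
    by_contra! hcon
    exact hne (eq_of_subset_of_card_le hcon (by omega)).symm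
  have h1 : (∑ w ∈ N, x w) ^ 2 ≤ N.card * ∑ w ∈ N, x w ^ 2 := sq_sum_le_card_mul_sum_sq
  have h2 : x w ^ 2 + ∑ w ∈ N, x w ^ 2 ≤ Z := by
    rw [← sum_insert (f := fun w => x w ^ 2) hw]
    exact hsub _ (insert_subset (hN' hw') hN)
  have h3 : 10 * l * x w ^ 2 ≤ Z := by
    rw [hc] at h1
    nlinarith
  have h4 : (∑ u ∈ N'.erase w, x u) ^ 2 ≤ (N'.erase w).card * ∑ u ∈ N'.erase w, x u ^ 2 :=
    sq_sum_le_card_mul_sum_sq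
  have h5 : ((N'.erase w).card : ℝ) = l - 1 := by
    rw [card_erase_of_mem hw', hc', Nat.cast_sub hl, Nat.cast_one]
  have h6 := hsub (N'.erase w) ((erase_subset _ _).trans hN')
  rw [← add_sum_erase _ _ hw'] at h'
  rw [h5] at h4
  have h7 : (∑ u ∈ N'.erase w, x u) ^ 2 ≤ (l - 1) * Z :=
    h4.trans (mul_le_mul_of_nonneg_left h6 (by linarith))
  generalize (∑ u ∈ N'.erase w, x u) = p at *
  -- Here `x_w² ≤ Z / (10l)` and `p² ≤ (l - 1)Z`; AM–GM is weighted so that the cross term costs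
  -- less than the `Z` lost in `p²`.
  have h8 : 2 * l * (2 * (x w * p)) ≤ p ^ 2 + 4 * l ^ 2 * x w ^ 2 := by
    nlinarith [sq_nonneg (p - 2 * l * x w)]
  have h9 : 4 * l ^ 2 * x w ^ 2 ≤ 2 / 5 * l * Z := by nlinarith
  have h10 : 2 * l * x w ^ 2 ≤ 1 / 5 * Z := by linarith
  have h11 : 2 * l * ((l - 1 / 10) * Z) < 2 * l * (x w + p) ^ 2 :=
    mul_lt_mul_of_pos_left h' (by linarith)
  have h12 : 2 * l * p ^ 2 ≤ 2 * l * ((l - 1) * Z) :=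
    mul_le_mul_of_nonneg_left h7 (by linarith)
  have h13 : Z ≤ l * Z := by nlinarith
  nlinarith

section
variable {α : Type*} [Fintype α] [DecidableEq α] {G : SimpleGraph α} {l m : ℕ}

/-- Split the quadratic form along `W`. The parts inside `W` and inside its complement are at most
`|W|` and `c` times the norm, so the crossing edges account for `θ`. AM–GM with weight `θ` then
cancels the mass outside `W`. -/
lemma sum_sq_le_of_eigen {x : α → ℝ} {r θ c : ℝ} {W : Finset α}
    (hx : ∀ u, ∑ v ∈ nbr G u, x v = r * x u) (hx0 : ∀ u, 0 ≤ x u) (hxne : x ≠ 0)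
    (hc : 0 ≤ c) (hW : ∑ u ∈ Wᶜ, ∑ v ∈ nbr G u ∩ Wᶜ, x u * x v ≤ c * ∑ u ∈ Wᶜ, x u ^ 2)
    (hθ : 0 < θ) (hr : θ + c + W.card ≤ r) :
    0 < ∑ w ∈ W, x w ^ 2 ∧
      θ ^ 2 * ∑ w ∈ W, x w ^ 2 ≤ ∑ v ∈ Wᶜ, (∑ w ∈ nbr G v ∩ W, x w) ^ 2 := by
  set Z := ∑ w ∈ W, x w ^ 2 with hZ
  set Y := ∑ w ∈ Wᶜ, x w ^ 2 with hY
  have hZ0 : 0 ≤ Z := sum_nonneg fun _ _ => sq_nonneg _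
  have hY0 : 0 ≤ Y := sum_nonneg fun _ _ => sq_nonneg _
  have hsplit : ∀ u, ∑ v ∈ nbr G u, x u * x v
      = ∑ v ∈ nbr G u ∩ W, x u * x v + ∑ v ∈ nbr G u ∩ Wᶜ, x u * x v := by
    intro u
    rw [← sum_inter_add_sum_sdiff (nbr G u) W, sdiff_eq_inter_compl]
  have hswap : ∑ u ∈ W, ∑ v ∈ nbr G u ∩ Wᶜ, x u * x v
      = ∑ v ∈ Wᶜ, ∑ u ∈ nbr G v ∩ W, x v * x u := by
    rw [sum_comm' (t' := Wᶜ) (s' := fun v => nbr G v ∩ W)]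
    · simp only [mul_comm]
    · intro u v
      simp only [mem_inter, mem_nbr, mem_compl, SimpleGraph.adj_comm]
      tauto
  have hquad : r * (Z + Y) = ∑ u ∈ W, ∑ v ∈ nbr G u ∩ W, x u * x v
      + 2 * ∑ v ∈ Wᶜ, x v * ∑ u ∈ nbr G v ∩ W, x u
      + ∑ u ∈ Wᶜ, ∑ v ∈ nbr G u ∩ Wᶜ, x u * x v := by
    have h1 := quad_eq_of_eigen hx
    rw [← sum_add_sum_compl W (fun u => x u ^ 2), quad, ← sum_add_sum_compl W] at h1
    rw [← h1]
    simp only [hsplit, sum_add_distrib]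
    rw [hswap]
    simp only [← mul_sum]
    ring
  have hWW : ∑ u ∈ W, ∑ v ∈ nbr G u ∩ W, x u * x v ≤ W.card * Z := by
    have h1 : ∑ u ∈ W, ∑ v ∈ nbr G u ∩ W, x u * x v ≤ ∑ u ∈ W, ∑ v ∈ W, x u * x v :=
      sum_le_sum fun u _ => sum_le_sum_of_subset_of_nonneg inter_subset_right
        fun v _ _ => mul_nonneg (hx0 u) (hx0 v)
    have h2 : ∑ u ∈ W, ∑ v ∈ W, x u * x v = (∑ w ∈ W, x w) ^ 2 := by
      rw [sq, sum_mul_sum]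
    rw [h2] at h1
    exact h1.trans sq_sum_le_card_mul_sum_sq
  have hcard : (0 : ℝ) ≤ W.card := Nat.cast_nonneg _
  have hmain : θ * (Z + Y) ≤ 2 * ∑ v ∈ Wᶜ, x v * ∑ u ∈ nbr G v ∩ W, x u := by
    have h1 := mul_le_mul_of_nonneg_right hr (add_nonneg hZ0 hY0)
    nlinarith [mul_nonneg hc hZ0, mul_nonneg hcard hY0]
  constructor
  · refine lt_of_le_of_ne hZ0 fun h0 => hxne ?_
    have hxW : ∀ w ∈ W, x w = 0 := fun w hw => by
      have := (sum_eq_zero_iff_of_nonneg fun i _ => sq_nonneg (x i)).1 h0.symm w hw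
      simpa using this
    have h1 : ∑ v ∈ Wᶜ, x v * ∑ u ∈ nbr G v ∩ W, x u = 0 := by
      refine sum_eq_zero fun v _ => ?_
      rw [sum_eq_zero fun u hu => hxW u (mem_inter.1 hu).2, mul_zero]
    rw [h1, ← h0] at hmain
    have h2 : Y = 0 := by nlinarith
    ext v
    by_cases hv : v ∈ W
    · exact hxW v hv
    · have := (sum_eq_zero_iff_of_nonneg fun i _ => sq_nonneg (x i)).1 h2 v (mem_compl.2 hv)
      simpa using this
  · have h1 : 2 * ∑ v ∈ Wᶜ, x v * ∑ u ∈ nbr G v ∩ W, x u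
        ≤ θ * Y + (∑ v ∈ Wᶜ, (∑ w ∈ nbr G v ∩ W, x w) ^ 2) / θ := by
      rw [hY, mul_sum, mul_sum, sum_div, ← sum_add_distrib]
      refine sum_le_sum fun v _ => ?_
      generalize ∑ u ∈ nbr G v ∩ W, x u = p
      have : θ * x v ^ 2 + p ^ 2 / θ - 2 * (x v * p) = (θ * x v - p) ^ 2 / θ := by
        field_simp
        ring
      have h4 : 0 ≤ (θ * x v - p) ^ 2 / θ := by positivity
      linarith
    have h2 : θ * Z ≤ (∑ v ∈ Wᶜ, (∑ w ∈ nbr G v ∩ W, x w) ^ 2) / θ := by linarith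
    rw [le_div_iff₀ hθ] at h2
    linarith

/-- Each such vertex is a common neighbour of some `(l + 1)`-subset of `W`. -/
lemma card_filter_lt_card_nbr_inter_le (W : Finset α)
    (hcom : ∀ S : Finset α, S.card = l + 1 → (common G S).card ≤ m) :
    (Wᶜ.filter fun v => l < (nbr G v ∩ W).card).card ≤ 2 ^ W.card * m := by
  have hsub : (Wᶜ.filter fun v => l < (nbr G v ∩ W).card)
      ⊆ (W.powersetCard (l + 1)).biUnion fun S => common G S := by
    intro v hv
    obtain ⟨S, hS, hSc⟩ := exists_subset_card_eq (Nat.succ_le_of_lt (mem_filter.1 hv).2)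
    simp only [mem_biUnion, mem_powersetCard, mem_common]
    refine ⟨S, ⟨hS.trans inter_subset_right, hSc⟩, fun w hw => ?_⟩
    exact (mem_nbr.1 (mem_inter.1 (hS hw)).1).symm
  refine (card_le_card hsub).trans ?_
  refine (card_biUnion_le_card_mul _ _ m fun S hS => hcom S (mem_powersetCard.1 hS).2).trans ?_
  refine Nat.mul_le_mul_right _ ?_
  rw [card_powersetCard]
  exact Nat.choose_le_two_pow _ _

/-- The vertices of `D`, where Cauchy–Schwarz is nearly tight, all have the same `l` neighbours in
`W`, by `eq_of_sq_sum_gt`. Any other vertex, apart from the at most `C` with more than `l`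
neighbours in `W`, falls short by `Z / 10`, so few lie outside `D`. -/
lemma exists_common_large {W : Finset α} {x : α → ℝ} {θ : ℝ} {C : ℕ} (hl : 1 ≤ l)
    (hZ : 0 < ∑ w ∈ W, x w ^ 2)
    (hQ : θ ^ 2 * ∑ w ∈ W, x w ^ 2 ≤ ∑ v ∈ Wᶜ, (∑ w ∈ nbr G v ∩ W, x w) ^ 2)
    (hC : (Wᶜ.filter fun v => l < (nbr G v ∩ W).card).card ≤ C)
    (hsmall : 10 * (l * Fintype.card α - θ ^ 2 + W.card * C) < Fintype.card α) :
    ∃ L : Finset α, L.card = l ∧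
      Fintype.card α ≤ (common G L).card + 10 * (l * Fintype.card α - θ ^ 2 + W.card * C) := by
  set Z := ∑ w ∈ W, x w ^ 2 with hZdef
  have hl' : (1 : ℝ) ≤ l := by exact_mod_cast hl
  let D : Finset α := Wᶜ.filter fun v => (nbr G v ∩ W).card ≤ l ∧
    (l - 1 / 10) * Z < (∑ w ∈ nbr G v ∩ W, x w) ^ 2
  have hbound : ∀ v ∈ Wᶜ, (∑ w ∈ nbr G v ∩ W, x w) ^ 2
      ≤ (l - 1 / 10) * Z + (if (nbr G v ∩ W).card ≤ l ∧
        (l - 1 / 10) * Z < (∑ w ∈ nbr G v ∩ W, x w) ^ 2 then Z / 10 else 0)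
        + if l < (nbr G v ∩ W).card then W.card * Z else 0 := by
    intro v _
    have h1 : (∑ w ∈ nbr G v ∩ W, x w) ^ 2 ≤ (nbr G v ∩ W).card * ∑ w ∈ nbr G v ∩ W, x w ^ 2 :=
      sq_sum_le_card_mul_sum_sq
    have h2 : ∑ w ∈ nbr G v ∩ W, x w ^ 2 ≤ Z :=
      sum_le_sum_of_subset_of_nonneg inter_subset_right fun _ _ _ => sq_nonneg _
    have h3 : (∑ w ∈ nbr G v ∩ W, x w) ^ 2 ≤ (nbr G v ∩ W).card * Z :=
      h1.trans (mul_le_mul_of_nonneg_left h2 (Nat.cast_nonneg _))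
    have h4 : 0 ≤ (l - 1 / 10) * Z := mul_nonneg (by linarith) hZ.le
    by_cases hlt : l < (nbr G v ∩ W).card
    · have h5 : ((nbr G v ∩ W).card : ℝ) ≤ W.card := by
        exact_mod_cast card_le_card inter_subset_right
      have h6 := mul_le_mul_of_nonneg_right h5 hZ.le
      rw [if_pos hlt, if_neg (fun h => h.1.not_gt hlt)]
      linarith
    · have h5 : ((nbr G v ∩ W).card : ℝ) ≤ l := by exact_mod_cast not_lt.1 hlt
      have h6 := mul_le_mul_of_nonneg_right h5 hZ.le
      rw [if_neg hlt]
      split_ifs with h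
      · linarith
      · have h7 : ¬ (l - 1 / 10) * Z < (∑ w ∈ nbr G v ∩ W, x w) ^ 2 :=
          fun h7 => h ⟨not_lt.1 hlt, h7⟩
        linarith
  have hsum := hQ.trans (sum_le_sum hbound)
  rw [sum_add_distrib, sum_add_distrib, ← sum_filter, ← sum_filter, sum_const, sum_const,
    sum_const, nsmul_eq_mul, nsmul_eq_mul, nsmul_eq_mul] at hsum
  have h1 : (Wᶜ.card : ℝ) * ((l - 1 / 10) * Z) ≤ Fintype.card α * ((l - 1 / 10) * Z) := by
    refine mul_le_mul_of_nonneg_right (by exact_mod_cast card_le_univ _) ?_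
    exact mul_nonneg (by linarith) hZ.le
  have h2 : ((Wᶜ.filter fun v => l < (nbr G v ∩ W).card).card : ℝ) * (W.card * Z)
      ≤ C * (W.card * Z) := by
    refine mul_le_mul_of_nonneg_right (by exact_mod_cast hC) ?_
    exact mul_nonneg (Nat.cast_nonneg _) hZ.le
  have h3 : θ ^ 2 * Z ≤ (Fintype.card α * (l - 1 / 10) + D.card / 10 + C * W.card) * Z := by
    have : (D.card : ℝ) * (Z / 10) = D.card / 10 * Z := by ring
    linarith
  have h4 := le_of_mul_le_mul_right h3 hZ
  have hDpos : (0 : ℝ) < D.card := by linarith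
  obtain ⟨v, hv⟩ : D.Nonempty := card_pos.1 (by exact_mod_cast hDpos)
  have hv' := (mem_filter.1 hv).2
  refine ⟨nbr G v ∩ W, ?_, ?_⟩
  · exact (eq_of_sq_sum_gt hl inter_subset_right inter_subset_right hv'.1 hv'.1 hv'.2
      hv'.2).2
  · have hsub : D ⊆ common G (nbr G v ∩ W) := by
      intro u hu
      have hu' := (mem_filter.1 hu).2
      have heq := (eq_of_sq_sum_gt hl inter_subset_right inter_subset_right hv'.1 hu'.1 hv'.2
        hu'.2).1
      rw [heq, mem_common]
      exact fun w hw => (mem_nbr.1 (mem_inter.1 hw).1).symm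
    have h5 : (D.card : ℝ) ≤ (common G (nbr G v ∩ W)).card := by
      exact_mod_cast card_le_card hsub
    linarith

lemma sum_card_nbr_le_of_orientation {out : α → Finset α} (hout : ∀ u, (out u).card ≤ m)
    (hcov : ∀ u v, G.Adj u v → v ∈ out u ∨ u ∈ out v) :
    ∑ v, (nbr G v).card ≤ 2 * m * Fintype.card α := by
  have hdeg : ∑ v, (nbr G v).card
      ≤ ∑ v, ((out v).card + (univ.filter fun u => v ∈ out u).card) := by
    refine sum_le_sum fun u _ => ?_
    refine le_trans (card_le_card fun v hv => ?_) (card_union_le _ _)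
    rw [mem_union, mem_filter]
    rcases hcov u v (mem_nbr.1 hv) with h | h
    · exact Or.inl h
    · exact Or.inr ⟨mem_univ _, h⟩
  have hcount : ∑ u, (univ.filter fun v => u ∈ out v).card = ∑ v, (out v).card := by
    have := sum_card_bipartiteAbove_eq_sum_card_bipartiteBelow (s := univ) (t := univ)
      (fun u v => u ∈ out v)
    simp only [bipartiteAbove, bipartiteBelow] at this
    rw [this]
    simp
  have hm : ∑ v, (out v).card ≤ Fintype.card α * m := by
    rw [← smul_eq_mul, ← card_univ]
    exact sum_le_card_nsmul _ _ _ fun v _ => hout v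
  rw [sum_add_distrib, hcount] at hdeg
  nlinarith

lemma card_filter_lt_card_nbr_le [Nonempty α] {out : α → Finset α} {c : ℝ} (hc : 0 < c)
    (hout : ∀ u, (out u).card ≤ m) (hcov : ∀ u v, G.Adj u v → v ∈ out u ∨ u ∈ out v) :
    (univ.filter fun v => c * Fintype.card α < (nbr G v).card).card ≤ ⌈2 * m / c⌉₊ := by
  have hn0 : (0 : ℝ) < Fintype.card α := by exact_mod_cast Fintype.card_pos
  set W : Finset α := univ.filter fun v => c * Fintype.card α < (nbr G v).card with hW
  have hdeg : ∑ v, ((nbr G v).card : ℝ) ≤ 2 * m * Fintype.card α := by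
    exact_mod_cast sum_card_nbr_le_of_orientation hout hcov
  have hlow : (W.card : ℝ) * (c * Fintype.card α) ≤ ∑ v, ((nbr G v).card : ℝ) := by
    rw [← nsmul_eq_mul]
    refine (card_nsmul_le_sum W (fun v => ((nbr G v).card : ℝ)) _ fun v hv =>
      (mem_filter.1 hv).2.le).trans ?_
    exact sum_le_sum_of_subset_of_nonneg (subset_univ _) fun _ _ _ => Nat.cast_nonneg _
  have h4 : (W.card : ℝ) ≤ 2 * m / c := by
    rw [le_div_iff₀ hc]
    have : (W.card * c) * Fintype.card α ≤ (2 * m) * Fintype.card α := by linarith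
    exact le_of_mul_le_mul_right this hn0
  have h5 := h4.trans (Nat.le_ceil _)
  exact_mod_cast h5

/-- `W` consists of the vertices of degree above `η²n`. With `t = η√n` the arcs outside `W`
contribute at most `(m + 1)η√n`, small against `λ` when `η` is small. -/
lemma exists_common_of_orientation [Nonempty α] {out : α → Finset α} {η θ : ℝ} {K : ℕ}
    (hl : 1 ≤ l) (hη : 0 < η) (hout : ∀ u, (out u).card ≤ m) (hsub : ∀ u, out u ⊆ nbr G u)
    (hcov : ∀ u v, G.Adj u v → v ∈ out u ∨ u ∈ out v)
    (hcom : ∀ S : Finset α, S.card = l + 1 → (common G S).card ≤ m)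
    (hK : ⌈2 * m / η ^ 2⌉₊ ≤ K) (hθ : 0 < θ)
    (hr : θ + (m + 1) * η * √(Fintype.card α) + K ≤ lam G)
    (hsmall : 10 * (l * Fintype.card α - θ ^ 2 + K * (2 ^ K * m : ℕ)) < Fintype.card α) :
    ∃ L : Finset α, L.card = l ∧
      Fintype.card α ≤ (common G L).card
        + 10 * (l * Fintype.card α - θ ^ 2 + K * (2 ^ K * m : ℕ)) := by
  set n : ℝ := (Fintype.card α : ℝ) with hndef
  have hn0 : 0 < n := by rw [hndef]; exact_mod_cast Fintype.card_pos
  have hsq : √n ^ 2 = n := Real.sq_sqrt hn0.le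
  have hsqpos : 0 < √n := Real.sqrt_pos.2 hn0
  let W : Finset α := univ.filter fun v => η ^ 2 * n < (nbr G v).card
  have hWK : W.card ≤ K := (card_filter_lt_card_nbr_le (by positivity) hout hcov).trans hK
  obtain ⟨x, hx0, hxne, hx⟩ := exists_perron G
  have hWc := sum_sum_nbr_inter_le (S := Wᶜ) (Δ := η ^ 2 * n) (t := η * √n) (y := x) hout hsub
    hcov (fun v hv => by simpa [W] using hv) (by positivity) hx0
  have hcc : η * √n * m + η ^ 2 * n / (η * √n) = (m + 1) * η * √n := by
    have : η ^ 2 * n / (η * √n) = η * √n := by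
      rw [div_eq_iff (by positivity)]
      linear_combination -η ^ 2 * hsq
    rw [this]
    ring
  rw [hcc] at hWc
  have hWK' : (W.card : ℝ) ≤ K := by exact_mod_cast hWK
  obtain ⟨hZ, hQ⟩ := sum_sq_le_of_eigen hx hx0 hxne (by positivity) hWc hθ (by linarith)
  have hC := card_filter_lt_card_nbr_inter_le W hcom
  have hCK : (W.card : ℝ) * (2 ^ W.card * m : ℕ) ≤ K * (2 ^ K * m : ℕ) := by
    have : W.card * (2 ^ W.card * m) ≤ K * (2 ^ K * m) := by
      gcongr
      norm_num
    exact_mod_cast this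
  obtain ⟨L, hL, hLc⟩ := exists_common_large hl hZ hQ hC (by linarith)
  exact ⟨L, hL, by linarith⟩

end

lemma eventually_add_mul_sqrt_le {c₀ c₁ ε : ℝ} (h₀ : 0 ≤ c₀) (hε : 0 < ε) :
    ∀ᶠ n : ℕ in Filter.atTop, c₀ + c₁ * √n ≤ ε * n := by
  have h1 : Filter.Tendsto (fun n : ℕ => √(n : ℝ)) Filter.atTop Filter.atTop :=
    Real.tendsto_sqrt_atTop.comp tendsto_natCast_atTop_atTop
  filter_upwards [h1.eventually_ge_atTop (max 1 ((c₀ + c₁) / ε))] with n h5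
  have h6 : (1 : ℝ) ≤ √n := (le_max_left _ _).trans h5
  have h7 := (div_le_iff₀ hε).1 ((le_max_right _ _).trans h5)
  have h8 : √(n : ℝ) ^ 2 = n := Real.sq_sqrt (Nat.cast_nonneg n)
  have h9 : (c₀ + c₁) * √n ≤ (√n * ε) * √n := mul_le_mul_of_nonneg_right h7 (by linarith)
  have h10 : c₀ * 1 ≤ c₀ * √n := mul_le_mul_of_nonneg_left h6 h₀
  have h11 : (√n * ε) * √n = ε * n := by linear_combination ε * h8
  linarith

/-- In a graph that can be oriented with bounded out-degrees, whose `(l+1)`-sets have boundedly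
many common neighbours and whose spectral radius is at least that of `K_{l,n-l}`, some `l` vertices
are joined to almost all vertices. -/
lemma eventually_exists_hub (l m : ℕ) (hl : 1 ≤ l) {ε : ℝ} (hε : 0 < ε) (hε1 : ε ≤ 1) :
    ∀ᶠ n : ℕ in Filter.atTop, ∀ (α : Type) [Fintype α] (G : SimpleGraph α)
      (out : α → Finset α), Fintype.card α = n → (∀ u, (out u).card ≤ m) →
      (∀ u, out u ⊆ nbr G u) → (∀ u v, G.Adj u v → v ∈ out u ∨ u ∈ out v) →
      (∀ S : Finset α, S.card = l + 1 → (common G S).card ≤ m) →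
      l * ((n : ℝ) - l) ≤ lam G ^ 2 → 0 ≤ lam G →
      ∃ L : Finset α, L.card = l ∧ (1 - ε) * n ≤ (common G L).card := by
  let M : ℝ := m + 1
  have hM : 1 ≤ M := by simp [M]
  -- With `θ = λ - Mη√n - K` and `λ ≤ M√n`, the linear part of `10(λ² - θ²)` is at most `20M²ηn`;
  -- this `η` makes it `εn / 4`. The remaining terms are `O(√n)`.
  let η : ℝ := ε / (80 * M ^ 2)
  have hη : 0 < η := by positivity
  have hηM : 20 * (M ^ 2 * η) = ε / 4 := by simp only [η]; field_simp; norm_num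
  have hηM' : M * η ≤ 1 / 4 := by nlinarith
  let K : ℕ := ⌈2 * m / η ^ 2⌉₊
  have h1 : Filter.Tendsto (fun n : ℕ => √(n : ℝ)) Filter.atTop Filter.atTop :=
    Real.tendsto_sqrt_atTop.comp tendsto_natCast_atTop_atTop
  filter_upwards [eventually_add_mul_sqrt_le (c₀ := 10 * (l ^ 2 + K * (2 ^ K * m : ℕ)))
    (c₁ := 20 * (M * K)) (ε := ε / 2) (by positivity) (by positivity),
    h1.eventually_gt_atTop (4 * (K + 1 : ℝ)),
    tendsto_natCast_atTop_atTop (R := ℝ) |>.eventually_ge_atTop (2 * (l : ℝ))]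
    with n hn1 hn2 hn3 α _ G out hn hout hsub hcov hcom hlam hlam0
  classical
  have hl' : (1 : ℝ) ≤ l := by exact_mod_cast hl
  have hn0 : (0 : ℝ) < n := by linarith
  have : Nonempty α := Fintype.card_pos_iff.1 (by rw [hn]; exact_mod_cast hn0)
  have hsq : √(n : ℝ) ^ 2 = n := Real.sq_sqrt hn0.le
  have hsqpos : 0 < √(n : ℝ) := Real.sqrt_pos.2 hn0
  have hup := lam_le_of_orientation hout hsub hcov
  have hlow : √(n : ℝ) / 2 ≤ lam G := by
    refine le_of_sq_le_sq ?_ hlam0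
    nlinarith
  have key := exists_common_of_orientation (η := η) (θ := lam G - M * η * √(n : ℝ) - K) (K := K) hl
    hη hout hsub hcov hcom le_rfl
  rw [hn] at key hup
  set r := lam G
  set q := √(n : ℝ)
  have hc : M * η * q ≤ 1 / 4 * q := mul_le_mul_of_nonneg_right hηM' hsqpos.le
  have hθ : 0 < r - M * η * q - K := by linarith
  have hμ : 0 ≤ M * η * q + K := by positivity
  have h4 : r ^ 2 - 2 * (r * (M * η * q + K)) ≤ (r - M * η * q - K) ^ 2 := by
    nlinarith [sq_nonneg (M * η * q + K)]
  have h5 : r * (M * η * q + K) ≤ M * q * (M * η * q + K) := mul_le_mul_of_nonneg_right hup hμ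
  have h6 : M * q * (M * η * q + K) = M ^ 2 * η * n + M * K * q := by
    linear_combination (M ^ 2 * η) * hsq
  have h7 : 20 * (M ^ 2 * η) * n = ε / 4 * n := by rw [hηM]
  have herr : 10 * (l * n - (r - M * η * q - K) ^ 2 + K * (2 ^ K * m : ℕ))
      ≤ ε / 4 * n + ε / 2 * n := by
    linarith
  have h8 : ε * n ≤ 1 * n := mul_le_mul_of_nonneg_right hε1 hn0.le
  have h9 : 0 < ε * n := by positivity
  obtain ⟨L, hL, hLc⟩ := key hθ (by simp only [M]; linarith) (by linarith)
  exact ⟨L, hL, by linarith⟩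

/-! ### Domination by `l` vertices -/

section
variable {V : Type*} [Fintype V] [DecidableEq V] {T : SimpleGraph V} {A : Finset V} {l δ : ℕ}

lemma IsHalf.le_card (hA : IsHalf T A l δ) : δ ≤ Fintype.card V := by
  obtain ⟨a, -, ha⟩ := hA.exists_card_nbr
  exact ha ▸ card_le_univ _

lemma card_common_le_of_free {α : Type*} [Fintype α] {G : SimpleGraph α} (hA : IsHalf T A l δ)
    (hG : T.Free G) {S : Finset α} (hS : S.card = l + 1) :
    (common G S).card ≤ Fintype.card V := by
  classical
  by_contra! hlt
  obtain ⟨v, hv⟩ : S.Nonempty := card_pos.1 (by omega)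
  refine hG (isContained_of_hub hA (L := S.erase v) (R := common G S) (v := v) ?_ ?_ ?_ ?_ hlt)
  · rw [card_erase_of_mem hv, hS]; rfl
  · simp
  · exact fun w hw r hr => mem_common.1 hr w (mem_of_mem_erase hw)
  · have : common G S ⊆ nbr G v ∩ common G S := fun u hu =>
      mem_inter.2 ⟨mem_nbr.2 (mem_common.1 hu v hv), hu⟩
    have h1 := card_le_card this
    have h2 := hA.le_card
    omega

/-- Off `L`, the two-step estimate gives `(n/2) x_v ≤ 2εn s + (n/4) x_v`, where `s` is the sum over
`L`. On `L`, `card_mul_sum_le` compares `|R| ≥ n/2` with `λ² ≤ M²n`. -/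
lemma entries_of_common {α : Type*} [Fintype α] [DecidableEq α] {G : SimpleGraph α} {n m : ℕ}
    {M ε : ℝ} {L E : Finset α} {x : α → ℝ} (hM : M = m + 1) (hε : ε = 1 / (64 * M ^ 3))
    (hx : ∀ u, ∑ v ∈ nbr G u, x v = lam G * x u) (hx0 : ∀ u, 0 ≤ x u) (hxne : x ≠ 0)
    (hlow : (n : ℝ) / 2 ≤ lam G ^ 2) (hup : lam G ≤ M * √n) (hlam0 : 0 ≤ lam G)
    (hn1 : M + M * √n ≤ ε * n) (hn2 : M ^ 2 ≤ n / 8) (hn0 : 0 < n)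
    (hEL : Disjoint E L) (hcov : ∀ v, v ∈ L ∨ v ∈ common G L ∨ v ∈ E)
    (hR : ∀ v ∉ L, (nbr G v ∩ common G L).card ≤ m)
    (hE : ∑ u ∈ E, (nbr G u ∩ E).card ≤ 2 * m * E.card)
    (hRc : (n : ℝ) / 2 ≤ (common G L).card) (hEc : (E.card : ℝ) ≤ ε * n) :
    0 < ∑ w ∈ L, x w ∧ (∀ w ∈ L, 1 / (2 * M ^ 2) * ∑ w ∈ L, x w ≤ x w) ∧
      ∀ v ∉ L, x v ≤ 1 / (8 * M ^ 3) * ∑ w ∈ L, x w := by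
  have hm0 : (0 : ℝ) ≤ m := Nat.cast_nonneg m
  have hM1 : 1 ≤ M := by linarith
  have hn0' : (0 : ℝ) < n := by exact_mod_cast hn0
  have hRL : Disjoint (common G L) L := by
    rw [disjoint_left]
    exact fun v hv hvL => G.irrefl (mem_common.1 hv v hvL)
  have hs0 : 0 ≤ ∑ w ∈ L, x w := sum_nonneg fun i _ => hx0 i
  have hsmall : ∀ v ∉ L, x v ≤ 1 / (8 * M ^ 3) * ∑ w ∈ L, x w := by
    intro v₀ hv₀
    obtain ⟨v, hv, hmax⟩ := Lᶜ.exists_max_image x ⟨v₀, mem_compl.2 hv₀⟩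
    refine (hmax v₀ (mem_compl.2 hv₀)).trans ?_
    have h1 := sq_mul_entry_le hx hx0 hlam0 hcov hEL hRL hR hE (mem_compl.1 hv)
      fun u hu => hmax u (mem_compl.2 hu)
    set s := ∑ w ∈ L, x w
    have hb := hx0 v
    have h2 : (n : ℝ) / 2 * x v ≤ lam G ^ 2 * x v := mul_le_mul_of_nonneg_right hlow hb
    have h3 : (lam G + m + E.card) * s ≤ (2 * ε * n) * s :=
      mul_le_mul_of_nonneg_right (by linarith) hs0
    have hεM : M * ε ≤ 1 / 64 := by
      rw [hε, mul_one_div, div_le_div_iff₀ (by positivity) (by norm_num)]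
      nlinarith [one_le_pow₀ hM1 (n := 2)]
    have h4 : (m : ℝ) * E.card ≤ 1 / 64 * n := by
      calc (m : ℝ) * E.card ≤ M * (ε * n) :=
            mul_le_mul (by linarith) hEc (Nat.cast_nonneg _) (by linarith)
        _ = M * ε * n := by ring
        _ ≤ 1 / 64 * n := mul_le_mul_of_nonneg_right hεM hn0'.le
    have h5 : ((m : ℝ) ^ 2 + 4 * m * E.card) * x v ≤ (n / 4) * x v := by
      refine mul_le_mul_of_nonneg_right ?_ hb
      have : (m : ℝ) ^ 2 ≤ M ^ 2 := pow_le_pow_left₀ hm0 (by linarith) 2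
      linarith
    have h6 : n * x v ≤ n * (8 * ε * s) := by linarith
    have h7 := le_of_mul_le_mul_left h6 hn0'
    have h8 : 8 * ε = 1 / (8 * M ^ 3) := by
      rw [hε]; field_simp; norm_num
    rwa [h8] at h7
  refine ⟨lt_of_le_of_ne hs0 fun h0 => hxne ?_, ?_, hsmall⟩
  · ext v
    by_cases hv : v ∈ L
    · exact (sum_eq_zero_iff_of_nonneg fun i _ => hx0 i).1 h0.symm v hv
    · have := hsmall v hv
      rw [← h0, mul_zero] at this
      exact le_antisymm this (hx0 v)
  · intro w hw
    have h1 := card_mul_sum_le hx hx0 hlam0 (L := L) (R := common G L)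
      (fun w hw v hv => mem_common.1 hv w hw) hw
    set s := ∑ w ∈ L, x w
    have h2 : (n : ℝ) / 2 * s ≤ (common G L).card * s := mul_le_mul_of_nonneg_right hRc hs0
    have h3 : lam G ^ 2 ≤ M ^ 2 * n := by
      have := pow_le_pow_left₀ hlam0 hup 2
      rwa [mul_pow, Real.sq_sqrt hn0'.le] at this
    have h4 := mul_le_mul_of_nonneg_right h3 (hx0 w)
    have h5 : n * s ≤ n * (2 * M ^ 2 * x w) := by linarith
    have h6 := le_of_mul_le_mul_left h5 hn0'
    rw [one_div, inv_mul_le_iff₀ (by positivity)]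
    exact h6

/-- In a large `T`-free graph of maximum spectral radius, some `l` vertices are joined to all
others, and the Perron vector is balanced on these vertices. -/
lemma eventually_exists_dominating (hT : T.IsTree) (hA : IsHalf T A l δ) (hl : 1 ≤ l) :
    ∃ κ : ℝ, 0 < κ ∧ ∀ᶠ n : ℕ in Filter.atTop, ∀ (α : Type) [Fintype α] [DecidableEq α]
      (G : SimpleGraph α), Fintype.card α = n → T.Free G →
      (∀ G' : SimpleGraph α, T.Free G' → lam G' ≤ lam G) →
      l * ((n : ℝ) - l) ≤ lam G ^ 2 → 0 ≤ lam G →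
      ∃ (L : Finset α) (x : α → ℝ), L.card = l ∧ (∀ w ∈ L, ∀ v ∉ L, G.Adj w v) ∧
        (∀ u, ∑ v ∈ nbr G u, x v = lam G * x u) ∧ (∀ u, 0 ≤ x u) ∧ 0 < ∑ w ∈ L, x w ∧
        (∀ w ∈ L, κ * ∑ w ∈ L, x w ≤ x w) ∧ ∀ v ∉ L, x v ≤ ∑ w ∈ L, x w := by
  obtain ⟨m, hm⟩ : ∃ m, m = Fintype.card V := ⟨_, rfl⟩
  obtain ⟨M, hM⟩ : ∃ M : ℝ, M = m + 1 := ⟨_, rfl⟩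
  -- This makes `8ε = 1 / (8M³)`, so that `2m` entries off `L` together stay below a single entry on
  -- `L`, which is at least `s / (2M²)`.
  obtain ⟨ε, hε⟩ : ∃ ε : ℝ, ε = 1 / (64 * M ^ 3) := ⟨_, rfl⟩
  have hM1 : 1 ≤ M := by rw [hM]; simp
  have hε0 : 0 < ε := by rw [hε]; positivity
  have hM3 : 1 ≤ M ^ 3 := one_le_pow₀ hM1
  have hε1 : ε ≤ 1 / 2 := by
    rw [hε, div_le_div_iff₀ (by positivity) (by norm_num)]
    linarith
  refine ⟨1 / (2 * M ^ 2), by positivity, ?_⟩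
  have htend := tendsto_natCast_atTop_atTop (R := ℝ)
  filter_upwards [eventually_exists_hub l m hl hε0 (by linarith),
    eventually_add_mul_sqrt_le (c₀ := M) (c₁ := M) (by linarith) hε0,
    htend.eventually_ge_atTop (8 * M ^ 2), htend.eventually_ge_atTop (2 * (l : ℝ)),
    htend.eventually_ge_atTop (4 * (m : ℝ) + 2)]
    with n hub hn1 hn2 hn3 hn4 α _ _ G hn hG hmax hlam hlam0
  have hl' : (1 : ℝ) ≤ l := by exact_mod_cast hl
  have hn0 : (0 : ℝ) < n := by linarith
  have hn0' : 0 < n := by exact_mod_cast hn0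
  have : Nonempty α := Fintype.card_pos_iff.1 (by rw [hn]; exact hn0')
  have hdeg := degenerate_of_free hT hG
  rw [← hm] at hdeg
  obtain ⟨out, hout, hsub, hcov⟩ := exists_orientation hdeg
  obtain ⟨L, hL, hLc⟩ := hub α G out hn hout hsub hcov
    (fun S hS => hm ▸ card_common_le_of_free hA hG hS) hlam hlam0
  have hLR : ∀ w ∈ L, ∀ v ∈ common G L, G.Adj w v := fun w hw v hv => mem_common.1 hv w hw
  set R := common G L with hRdef
  let E : Finset α := (L ∪ R)ᶜ
  have hRL : Disjoint R L := by
    rw [disjoint_left]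
    exact fun v hv hvL => G.irrefl (hLR v hvL v hv)
  have hEmem : ∀ v, v ∈ E ↔ v ∉ L ∧ v ∉ R := fun v => by simp [E]
  have hEL : Disjoint E L := by
    rw [disjoint_left]
    exact fun v hv => ((hEmem v).1 hv).1
  have hcov' : ∀ v, v ∈ L ∨ v ∈ R ∨ v ∈ E := fun v => by rw [hEmem]; tauto
  have hRhalf : (n : ℝ) / 2 ≤ R.card := by
    have : ε * n ≤ 1 / 2 * n := mul_le_mul_of_nonneg_right hε1 hn0.le
    linarith
  have hR2m : 2 * m + 1 ≤ R.card := by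
    have : (2 * m + 1 : ℝ) ≤ R.card := by linarith
    exact_mod_cast this
  have hEc : (E.card : ℝ) ≤ ε * n := by
    have h1 : Disjoint R E := by
      rw [disjoint_left]
      exact fun v hv hE => ((hEmem v).1 hE).2 hv
    have h2 := card_le_univ (R ∪ E)
    rw [card_union_of_disjoint h1, hn] at h2
    have h3 : (R.card : ℝ) + E.card ≤ n := by exact_mod_cast h2
    linarith
  have hRm : ∀ v ∉ L, (nbr G v ∩ R).card ≤ m := by
    intro v hv
    by_contra! hlt
    have := hA.le_card
    exact hG (isContained_of_hub hA hL hv hLR (by omega) (by omega))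
  have hEm := sum_card_nbr_inter_le hdeg E
  have hup := lam_le_of_orientation hout hsub hcov
  rw [hn, ← hM] at hup
  obtain ⟨x, hx0, hxne, hx⟩ := exists_perron G
  have hlow : (n : ℝ) / 2 ≤ lam G ^ 2 := by nlinarith
  obtain ⟨hs, hbig, hsmall⟩ := entries_of_common hM hε hx hx0 hxne hlow hup hlam0 hn1
    (by linarith) hn0' hEL hcov' hRm hEm hRhalf hEc
  refine ⟨L, x, hL, ?_, hx, hx0, hs, hbig, fun v hv => (hsmall v hv).trans ?_⟩
  · have hempty : E = ∅ := by
      -- The edges lost at `u ∈ E` are its arcs inside `E`, at most `m` by orientation, and its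
      -- edges to `R`, at most `m` by the hub lemma.
      refine eq_empty_of_lam_reattach_le (out := fun u => (out u ∩ E) ∪ (nbr G u ∩ R))
        (D := m + m) hx hx0 hEL
        (hmax _ (free_reattach hG hEL hLR (by omega))) ?_ (fun u hu => ?_) ?_ ?_ hsmall
        (by positivity) ?_
      · intro u hu
        have h1 := ((hEmem u).1 hu).2
        rw [hRdef, mem_common] at h1
        push Not at h1
        obtain ⟨w, hw, h2⟩ := h1
        exact ⟨w, hw, fun h => h2 h.symm⟩
      · exact (card_union_le _ _).trans (add_le_add
          ((card_le_card inter_subset_left).trans (hout u)) (hRm u ((hEmem u).1 hu).1))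
      · intro u hu
        rw [disjoint_union_left]
        exact ⟨hEL.mono_left inter_subset_right, hRL.mono_left inter_subset_right⟩
      · intro u hu v hv huv
        simp only [mem_union, mem_inter, mem_nbr]
        rcases hcov' v with h | h | h
        · exact absurd h hv
        · exact Or.inl (Or.inr ⟨huv, h⟩)
        · rcases hcov u v huv with h' | h'
          · exact Or.inl (Or.inl ⟨h', h⟩)
          · exact Or.inr ⟨h, Or.inl ⟨h', hu⟩⟩
      · intro w hw
        refine lt_of_lt_of_le ?_ (hbig w hw)
        rw [← mul_assoc]
        refine mul_lt_mul_of_pos_right ?_ hs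
        rw [mul_one_div, div_lt_div_iff₀ (by positivity) (by positivity)]
        have h1 : (m : ℝ) < M := by rw [hM]; linarith
        push_cast
        have h2 : 0 < M ^ 2 := by positivity
        have h3 : M ^ 2 * m < M ^ 2 * M := mul_lt_mul_of_pos_left h1 h2
        have h4 : M ^ 3 = M ^ 2 * M := by ring
        rw [h4]
        linarith
    intro w hw v hv
    rcases hcov' v with h | h | h
    · exact absurd h hv
    · exact hLR w hw v h
    · simp [hempty] at h
  · have : 1 / (8 * M ^ 3) ≤ 1 := by
      rw [div_le_one (by positivity)]
      linarith
    have := mul_le_mul_of_nonneg_right this hs.le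
    linarith

end

/-! ### Extremal graphs as joins, and the two bounds -/

lemma sum_nbr_iso {α β : Type*} [Fintype α] [Fintype β] {G : SimpleGraph α} {H : SimpleGraph β}
    (e : H ≃g G) (x : α → ℝ) (u : β) : ∑ v ∈ nbr H u, x (e v) = ∑ v ∈ nbr G (e u), x v := by
  refine sum_bij (fun v _ => e v) ?_ (fun _ _ _ _ h => e.injective h) ?_ fun _ _ => rfl
  · intro v hv
    rw [mem_nbr] at hv ⊢
    exact e.map_adj_iff.2 hv
  · intro v hv
    rw [mem_nbr] at hv
    refine ⟨e.symm v, ?_, by simp⟩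
    rw [mem_nbr, ← e.map_adj_iff]
    simpa using hv

lemma exists_iso_join {α : Type*} [Fintype α] [DecidableEq α] {G : SimpleGraph α} {L : Finset α}
    {l n : ℕ} (hn : Fintype.card α = n) (hL : L.card = l)
    (hadj : ∀ w ∈ L, ∀ v ∉ L, G.Adj w v) :
    ∃ (G₁ : SimpleGraph (Fin l)) (H : SimpleGraph (Fin (n - l))) (e : join G₁ H ≃g G),
      (∀ i, e (Sum.inl i) ∈ L) ∧ (∀ v, e (Sum.inr v) ∉ L) := by
  let e₁ : Fin l ≃ {v // v ∈ L} := (L.equivFinOfCardEq hL).symm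
  have hc : Fintype.card {v // v ∉ L} = n - l := by
    rw [Fintype.card_subtype_compl, hn, Fintype.card_coe, hL]
  let e₂ : Fin (n - l) ≃ {v // v ∉ L} := (Fintype.equivFinOfCardEq hc).symm
  let e : Fin l ⊕ Fin (n - l) ≃ α := (Equiv.sumCongr e₁ e₂).trans (Equiv.sumCompl (· ∈ L))
  have h1 : ∀ i, e (Sum.inl i) ∈ L := fun i => by simp [e]
  have h2 : ∀ i, e (Sum.inr i) ∉ L := fun i => by simpa [e] using (e₂ i).2
  refine ⟨G.comap (e ∘ Sum.inl), G.comap (e ∘ Sum.inr), ⟨e, ?_⟩, h1, h2⟩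
  rintro (a | a) (b | b)
  · rw [join_adj_inl_inl]; rfl
  · exact iff_of_true (hadj _ (h1 a) _ (h2 b)) join_adj_inl_inr
  · exact iff_of_true (hadj _ (h1 b) _ (h2 a)).symm join_adj_inr_inl
  · rw [join_adj_inr_inr]; rfl

lemma tendsto_f_atTop {l : ℕ} {x : ℝ} (hl : 1 ≤ l) (hx : 0 ≤ x) :
    Filter.Tendsto (fun n => f l x n) Filter.atTop Filter.atTop := by
  have h1 : Filter.Tendsto (fun n : ℕ => √(n : ℝ) * (1 / 2)) Filter.atTop Filter.atTop :=
    (Real.tendsto_sqrt_atTop.comp tendsto_natCast_atTop_atTop).atTop_mul_const (by norm_num)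
  refine Filter.tendsto_atTop_mono' _ ?_ h1
  filter_upwards [Filter.eventually_ge_atTop (2 * l)] with n hn
  have hn' : (2 * l : ℝ) ≤ n := by exact_mod_cast hn
  have hl' : (1 : ℝ) ≤ l := by exact_mod_cast hl
  have h2 := mul_le_f_sq (x := x) (by omega : l ≤ n) hl hx
  have h3 := (max_le_f (x := x) (by omega : l ≤ n)).1
  refine le_of_sq_le_sq ?_ (hx.trans h3)
  rw [mul_pow, Real.sq_sqrt (by linarith)]
  nlinarith

/-- The witness is `K_l` joined to a nearly `d`-regular graph. The single vertex of degree `d + 1`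
that parity may force is harmless, since a copy of `T` would need two. -/
lemma exists_card_eq_free_join {V : Type*} [Fintype V] [DecidableEq V] {T : SimpleGraph V}
    {A : Finset V} {l d n : ℕ} (hT : T.IsTree) (hA : IsHalf T A l (d + 2)) (hl : 1 ≤ l)
    (hn : 2 * d + 4 + l ≤ n) :
    f l d n ≤ spex n T ∧ ∃ G : SimpleGraph (Fin n), T.Free G := by
  obtain ⟨β, _, H, hβ, h1, h2, h3⟩ := exists_nearRegular d (n - l) (by omega)
  have hcard : Fintype.card (Fin l ⊕ β) = n := by
    rw [Fintype.card_sum, Fintype.card_fin, hβ]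
    omega
  have hfree : T.Free (join (⊤ : SimpleGraph (Fin l)) H) :=
    free_join hT hA (by simp) (fun w => by have := h2 w; omega)
      fun w w' hw hw' => h3 w w' (by omega) (by omega)
  constructor
  · refine le_trans ?_ (lam_le_spex hcard hfree)
    have hβ' : (Fintype.card β : ℝ) = n - l := by
      rw [hβ, Nat.cast_sub (by omega)]
    refine le_lam_join_top (d := d) ?_ (max_le_f (by omega)).1 hl ?_ h1
    · rw [hβ', f_mul (by omega)]
    · exact Fintype.card_pos_iff.1 (by omega)
  · obtain ⟨G, ⟨e⟩⟩ := exists_iso_fin _ hcard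
    exact ⟨G, fun h => hfree (h.trans ⟨e.symm.toCopy⟩)⟩

lemma eventually_iso_join_top {V : Type*} [Fintype V] [DecidableEq V] {T : SimpleGraph V}
    {A : Finset V} {m l d : ℕ} (hT : T.IsTree) (hA : IsHalf T A l (d + 2)) (hl : 1 ≤ l)
    (hemb : T.IsContained (join (⊥ : SimpleGraph (Fin l)) (copies m (star (d + 2))))) :
    ∀ᶠ n in Filter.atTop, ∀ G ∈ SPEX n T, ∃ H : SimpleGraph (Fin (n - l)),
      Nonempty (G ≃g join (⊤ : SimpleGraph (Fin l)) H) ∧ (∀ v, (nbr H v).card ≤ d + 1) ∧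
        (univ.filter fun v => (nbr H v).card = d + 1).card ≤ (m - 1) * ((d + 1) ^ 2 + 1) := by
  obtain ⟨κ, hκ, hdom⟩ := eventually_exists_dominating hT hA hl
  have hf := (tendsto_f_atTop hl (Nat.cast_nonneg (α := ℝ) d))
  -- The last threshold is `lC < κ(f - d)`, the condition under which a missing edge in `G₁` cannot
  -- be compensated.
  filter_upwards [hdom, Filter.eventually_ge_atTop (2 * d + 4 + l + Fintype.card V),
    hf.eventually_gt_atTop (l * ((m - 1) * ((d + 1) ^ 2 + 1) : ℕ) / κ + d)]
    with n hn1 hn2 hn3 G hG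
  have hfspex := (exists_card_eq_free_join hT hA hl (n := n) (by omega)).1
  have hflam : f l d n ≤ lam G := hG.2 ▸ hfspex
  have hdf := (max_le_f (l := l) (n := n) (x := d) (by omega))
  have hf0 : 0 ≤ f l d n := (Nat.cast_nonneg d).trans hdf.1
  obtain ⟨L, x, hL, hadj, hx, hx0, hs, hbig, hsmall⟩ := hn1 (Fin n) G (by simp) hG.1
    (fun G' hG' => hG.2 ▸ lam_le_spex_fin hG')
    ((mul_le_f_sq (by omega) hl (Nat.cast_nonneg d)).trans (pow_le_pow_left₀ hf0 hflam 2))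
    (hf0.trans hflam)
  obtain ⟨G₁, H, e, he₁, he₂⟩ := exists_iso_join (Fintype.card_fin n) hL hadj
  have hfree : T.Free (join G₁ H) := fun h => hG.1 (h.trans ⟨e.toCopy⟩)
  have hdeg : ∀ v, (nbr H v).card ≤ d + 1 := fun v => by
    have := card_nbr_lt_of_free_join hA (Fintype.card_fin l)
      (by rw [Fintype.card_fin]; omega) hfree v
    omega
  have hcount := card_filter_card_nbr_le_of_free_join hemb hfree hdeg
  have hsum : ∑ i, x (e (Sum.inl i)) = ∑ w ∈ L, x w := by
    rw [← sum_image (f := x) (g := fun i => e (Sum.inl i)) (s := univ)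
      fun i _ j _ h => Sum.inl_injective (e.injective h)]
    congr 1
    refine eq_of_subset_of_card_le ?_ ?_
    · intro w hw
      obtain ⟨i, -, rfl⟩ := mem_image.1 hw
      exact he₁ i
    · rw [card_image_of_injective _ fun i j h => Sum.inl_injective (e.injective h), hL]
      simp
  have htop : G₁ = ⊤ := by
    have hcard : (Fintype.card (Fin (n - l)) : ℝ) = n - l := by
      rw [Fintype.card_fin, Nat.cast_sub (by omega)]
    refine eq_top_of_le_lam (y := fun u => x (e u)) (r := lam G) (q := f l d n) (κ := κ)
      (fun u => by rw [sum_nbr_iso e x u, hx]) (fun u => hx0 _) hdeg hcount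
      ?_ ?_ ?_ hκ.le ?_ hdf.1 hdf.2 hflam ?_
    · rwa [hsum]
    · intro v
      rw [hsum]
      exact hsmall _ (he₂ v)
    · intro i
      rw [hsum]
      exact hbig _ (he₁ i)
    · rw [hcard, f_mul (by omega)]
    · rw [mul_comm κ, ← div_lt_iff₀ hκ]
      exact lt_sub_iff_add_lt.2 hn3
  subst htop
  exact ⟨H, ⟨e.symm⟩, hdeg, hcount⟩

lemma eventually_lam_join_top_le {l d C : ℕ} (hl : 1 ≤ l) :
    ∀ᶠ n : ℕ in Filter.atTop, ∀ H : SimpleGraph (Fin (n - l)), (∀ v, (nbr H v).card ≤ d + 1) →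
      (univ.filter fun v => (nbr H v).card = d + 1).card ≤ C →
      lam (join (⊤ : SimpleGraph (Fin l)) H) ≤ f l d n + 2 * C / n := by
  have hf := (tendsto_f_atTop hl (Nat.cast_nonneg (α := ℝ) d))
  filter_upwards [Filter.eventually_ge_atTop (2 * l),
    hf.eventually_gt_atTop (3 * d + l + 2)] with n hn1 hn2 H hdeg hcount
  have hn1' : (2 * l : ℝ) ≤ n := by exact_mod_cast hn1
  have hl' : (1 : ℝ) ≤ l := by exact_mod_cast hl
  have hd : (0 : ℝ) ≤ d := Nat.cast_nonneg d
  have hC : (0 : ℝ) ≤ C := Nat.cast_nonneg C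
  have hn0 : (0 : ℝ) < n := by linarith
  have hcard : (Fintype.card (Fin (n - l)) : ℝ) = n - l := by
    rw [Fintype.card_fin, Nat.cast_sub (by omega)]
  have hsq := mul_le_f_sq (x := d) (by omega : l ≤ n) hl hd
  refine lam_join_top_le hl hdeg hcount ?_ ?_ (max_le_f (by omega)).2 (by positivity) ?_
  · rw [hcard, f_mul (by omega)]
  · linarith
  · set q := f l d n
    -- For `q > 3d + l + 2` the product is at least `q²`, and `q² ≥ l(n - l) ≥ ln / 2` because `n ≥
    -- 2l`. This is the origin of the error term `2C / n`.
    have h1 : (l : ℝ) * n / 2 ≤ (2 * q - d - (l - 1)) * (q - (d + 1)) := by nlinarith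
    calc (l : ℝ) * C = 2 * C / n * (l * n / 2) := by field_simp
      _ ≤ _ := mul_le_mul_of_nonneg_left h1 (by positivity)

end TreeSpex

/-! ### Conclusion -/

open TreeSpex in
theorem theorem1p7 {V : Type*} [Fintype V] (T : SimpleGraph V) (m l δ : ℕ)
    (hT : TreeSpex.TreeFamily m (l + 1) δ T)
    (hemb : T.IsContained
      (TreeSpex.join (⊥ : SimpleGraph (Fin l)) (TreeSpex.copies m (TreeSpex.star δ)))) :
    ∃ N : ℕ, ∀ n : ℕ, N < n →
      (∀ G ∈ TreeSpex.SPEX n T,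
        ∃ (H₂ : SimpleGraph (Fin (n - l))) (_ : DecidableRel H₂.Adj),
          Nonempty (G ≃g TreeSpex.join (⊤ : SimpleGraph (Fin l)) H₂) ∧
          H₂.maxDegree ≤ δ - 1 ∧
          (Finset.univ.filter (fun v => H₂.degree v = δ - 1)).card
            ≤ (m - 1) * ((δ - 1) ^ 2 + 1)) ∧
      TreeSpex.f l ((δ : ℝ) - 2) n ≤ TreeSpex.spex n T ∧
      TreeSpex.spex n T ≤ TreeSpex.f l ((δ : ℝ) - 2) n
        + 2 * ((m : ℝ) - 1) * (((δ : ℝ) - 1) ^ 2 + 1) / n := by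
  classical
  obtain ⟨htree, hm, A, hA⟩ := hT.exists_isHalf
  -- Since `δ ≥ 2`, the substitution `δ = d + 2` makes every truncated subtraction exact.
  obtain ⟨d, rfl⟩ := Nat.exists_eq_add_of_le' (two_le_of_isContained htree hA hemb)
  have hl := one_le_of_isContained htree hA hemb
  have hm1 : 1 ≤ m := by
    have := hA.le_card
    omega
  obtain ⟨N, hN⟩ := Filter.eventually_atTop.1 ((eventually_iso_join_top htree hA hl hemb).and
    ((eventually_lam_join_top_le (d := d) (C := (m - 1) * ((d + 1) ^ 2 + 1)) hl).and
      (Filter.eventually_ge_atTop (2 * d + 4 + l))))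
  refine ⟨N, fun n hn => ?_⟩
  obtain ⟨h1, h2, h3⟩ := hN n hn.le
  have hx : ((d + 2 : ℕ) : ℝ) - 2 = d := by push_cast; ring
  obtain ⟨hlow, hfree⟩ := exists_card_eq_free_join htree hA hl h3
  rw [hx]
  refine ⟨fun G hG => ?_, hlow, ?_⟩
  · obtain ⟨H, e, hdeg, hcount⟩ := h1 G hG
    have hd : ∀ v, H.degree v = (nbr H v).card := fun v => by
      rw [← SimpleGraph.card_neighborFinset_eq_degree]
      congr 1
      ext
      simp
    rw [show d + 2 - 1 = d + 1 from rfl]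
    refine ⟨H, Classical.decRel _, e, ?_, ?_⟩
    · refine SimpleGraph.maxDegree_le_of_forall_degree_le _ _ fun v => ?_
      convert hdeg v
      convert hd v
    · convert hcount using 4 with v
      convert hd v
  · obtain ⟨G, hG, hGs⟩ := (isGreatest_spex n T hfree).1
    obtain ⟨H, ⟨e⟩, hdeg, hcount⟩ := h1 G ⟨hG, hGs⟩
    have h4 := h2 H hdeg hcount
    rw [← lam_eq_of_iso e, hGs] at h4
    refine h4.trans_eq ?_
    push_cast [Nat.cast_sub hm1]
    ring
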